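/- Let $H$ be a real Hilbert space with scalar product $\langle\cdot,\cdot\rangle$, and let $A$ be a densely defined self-adjoint operator on $H$ with compact injection $D(A)\subset H$ such that, for some $a>0$, $\langle Au,u\rangle\ge a\|u\|^2$ for all $u\in D(A)$. Let $\lambda_1$ be its smallest eigenvalue, and for an orthonormal basis $(e_i)$ of eigenvectors, $Ae_i=\lambda_ie_i$, put $A^s u=\sum_i\lambda_i^s\langle u,e_i\rangle e_i$. Let $V=D(A^{1/2})$ and $W=D(A)$, with norms $\|A^{1/2}u\|$ and $\|Au\|$, so that $W\subset V\subset H\subset V'\subset W'$. Let $\beta\in[0,\tfrac32]$ and $\alpha\in\mathbb R$ with $$|\alpha|<\lambda_1^{(3-2\beta)/2}.$$ Let $\mathcal H=V\times W\times H\times H$ with the scalar product $$\langle U_1,U_2\rangle_{\mathcal H}=\langle Au_2+\alpha A^\beta v_2,u_1\rangle_{V',V}+\langle A^2v_2+\alpha A^\beta u_2,v_1\rangle_{W',W}+\langle w_1,w_2\rangle+\langle z_1,z_2\rangle,\qquad U_i=(u_i,v_i,w_i,z_i),$$ and let $\mathcal A$ be the unbounded operator on $\mathcal H$ given by $$\mathcal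 A(u,v,w,z)=(-w,\,-z,\,Au+\alpha A^\beta v+w,\,A^2v+\alpha A^\beta u),\qquad D(\mathcal A)=\{U\in\mathcal H:\mathcal AU\in\mathcal H\}.$$ Let $D(\mathcal A)'$ be the dual of $D(\mathcal A)$ (with its graph norm), where $\mathcal H\subset D(\mathcal A)'$ through $\langle\cdot,\cdot\rangle_{\mathcal H}$, and extend $\mathcal A$ by density to $\mathcal H\to D(\mathcal A)'$. Then for every $T>0$ and every $(u_0,v_0,u_1,v_1)\in\mathcal H$ there is a unique $U=(u,v,w,z)\in C([0,T];\mathcal H)\cap C^1([0,T];D(\mathcal A)')$ with $U'+\mathcal AU=0$ in $D(\mathcal A)'$ on $[0,T]$ and $U(0)=(u_0,v_0,u_1,v_1)$. It satisfies $w=u'$ and $z=v'$ in $H$, and $(u,v)$ solves $$u''+u'+Au+\alpha A^\beta v=0\ \text{ in } V',\qquad v''+A^2v+\alpha A^\beta u=0\ \text{ in } W',$$ on $[0,T]$, in the sense that for all $r\in V$ and $s\in W$ the functions $\langle u'(t),r\rangle$ and $\langle v'(t),s\rangle$ are differentiable on $[0,T]$ with derivatives given by these equations. -/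

import Mathlib

open Set Filter Topology
open scoped InnerProductSpace

noncomputable section

/-- An (in general unbounded) self-adjoint operator `A` on a real Hilbert space `H`, densely
defined, with compact injection `D(A) ⊂ H` (for the graph norm, i.e. `D(A)` is identified with the
graph of `A` in `H × H`) and with `⟨Au, u⟩ ≥ a ⟨u, u⟩` on `D(A)` for some `a > 0`. A self-adjoint
operator is closed. -/
structure CoerciveOp (H : Type*) [NormedAddCommGroup H] [InnerProductSpace ℝ H]
    [CompleteSpace H] where
  op : H →ₗ.[ℝ] H
  dense_domain : Dense (op.domain : Set H)
  selfAdjoint : IsSelfAdjoint op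
  compact_injection : IsCompactOperator (fun p : op.graph => (p : H × H).1)
  coercive : ∃ a : ℝ, 0 < a ∧ ∀ u : op.domain, a * ⟪(u : H), (u : H)⟫_ℝ ≤ ⟪op u, (u : H)⟫_ℝ

namespace CoerciveOp

variable {H : Type*} [NormedAddCommGroup H] [InnerProductSpace ℝ H] [CompleteSpace H]
  (A : CoerciveOp H)

/-- The eigenspace `ker (A - μ)`; it is `0` unless `μ` is an eigenvalue. -/
def eigenspace (μ : ℝ) : Submodule ℝ H where
  carrier := {u | ∃ h : u ∈ A.op.domain, A.op ⟨u, h⟩ = μ • u}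
  add_mem' := by
    rintro u v ⟨hu, hu'⟩ ⟨hv, hv'⟩
    refine ⟨add_mem hu hv, ?_⟩
    have := A.op.map_add ⟨u, hu⟩ ⟨v, hv⟩
    rw [hu', hv', ← smul_add] at this
    exact this
  zero_mem' := ⟨zero_mem _, by
    have := A.op.map_zero
    rw [smul_zero]; exact this⟩
  smul_mem' := by
    rintro c u ⟨hu, hu'⟩
    refine ⟨A.op.domain.smul_mem c hu, ?_⟩
    have := A.op.map_smul c ⟨u, hu⟩
    rw [hu', smul_comm] at this
    exact this

/-- The smallest eigenvalue `λ₁` of `A`. -/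
def lambda1 : ℝ := sInf {μ : ℝ | A.eigenspace μ ≠ ⊥}

lemma symm (u v : A.op.domain) : ⟪A.op u, (v : H)⟫_ℝ = ⟪(u : H), A.op v⟫_ℝ := by
  have h := LinearPMap.adjoint_isFormalAdjoint A.dense_domain
  rw [LinearPMap.isSelfAdjoint_def.mp A.selfAdjoint] at h
  exact h u v

lemma isClosed_eigenspace (μ : ℝ) : IsClosed (A.eigenspace μ : Set H) := by
  have hc : IsClosed (A.op.graph : Set (H × H)) := A.selfAdjoint.isClosed
  have : (A.eigenspace μ : Set H) = (fun u : H => (u, μ • u)) ⁻¹' (A.op.graph : Set (H × H)) := by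
    ext u
    simp only [mem_preimage, SetLike.mem_coe, LinearPMap.mem_graph_iff]
    constructor
    · rintro ⟨h, h'⟩
      exact ⟨⟨u, h⟩, rfl, h'⟩
    · rintro ⟨⟨y, hy⟩, rfl, h'⟩
      exact ⟨hy, h'⟩
  rw [this]
  exact hc.preimage (by fun_prop)

instance (μ : ℝ) : CompleteSpace (A.eigenspace μ) :=
  (A.isClosed_eigenspace μ).completeSpace_coe

/-- The orthogonal projection of `H` onto the eigenspace of `μ`. If `(e_i)` is an orthonormal basis
of eigenvectors, this is `u ↦ ∑_{λ_i = μ} ⟨u, e_i⟩ e_i`. -/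
def eigenProj (μ : ℝ) : H →L[ℝ] H := (A.eigenspace μ).starProjection

/-- The power `A ^ s`, that is `A ^ s u = ∑_i λ_i ^ s ⟨u, e_i⟩ e_i` (the terms are grouped by
eigenvalue) with domain the set of all `u ∈ H` for which the series converges in `H`. -/
def power (s : ℝ) : H →ₗ.[ℝ] H where
  domain :=
    { carrier := {u | Summable fun μ : ℝ => μ ^ s • A.eigenProj μ u}
      add_mem' := fun {u v} hu hv => by
        simpa only [Set.mem_ofPred_eq, map_add, smul_add] using Summable.add hu hv
      zero_mem' := by
        simpa only [Set.mem_ofPred_eq, map_zero, smul_zero] using summable_zero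
      smul_mem' := fun c u hu => by
        have := Summable.const_smul c hu
        simpa only [Set.mem_ofPred_eq, map_smul, smul_comm c] using this }
  toFun :=
    { toFun := fun u => ∑' μ : ℝ, μ ^ s • A.eigenProj μ (u : H)
      map_add' := fun u v => by
        rw [← Summable.tsum_add u.2 v.2]
        simp only [Submodule.coe_add, map_add, smul_add]
      map_smul' := fun c u => by
        rw [RingHom.id_apply, ← Summable.tsum_const_smul c u.2]
        simp only [Submodule.coe_smul, map_smul, smul_comm c] }

/-- `V = D(A ^ (1/2))`. -/
def V : Type _ := (A.power (1 / 2)).domain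

/-- `W = D(A)`. -/
def W : Type _ := A.op.domain

instance : AddCommGroup A.V := inferInstanceAs (AddCommGroup (A.power (1 / 2)).domain)
instance : Module ℝ A.V := inferInstanceAs (Module ℝ (A.power (1 / 2)).domain)
instance : AddCommGroup A.W := inferInstanceAs (AddCommGroup A.op.domain)
instance : Module ℝ A.W := inferInstanceAs (Module ℝ A.op.domain)

/-- The inclusion `V ⊂ H`. -/
def inclV : A.V →ₗ[ℝ] H := (A.power (1 / 2)).domain.subtype

/-- The inclusion `W ⊂ H`. -/
def inclW : A.W →ₗ[ℝ] H := A.op.domain.subtype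

/-- `A ^ (1/2) : V → H`. -/
def sqrtV : A.V →ₗ[ℝ] H := (A.power (1 / 2)).toFun

/-- `A : W → H`. -/
def mapW : A.W →ₗ[ℝ] H := A.op.toFun

/-- `‖u‖_V = ‖A ^ (1/2) u‖`. (This is a norm, because `A ^ (1/2)` is injective.) -/
instance : SeminormedAddCommGroup A.V := SeminormedAddCommGroup.induced A.V H A.sqrtV
instance : NormedSpace ℝ A.V := NormedSpace.induced ℝ A.V H A.sqrtV

/-- `‖v‖_W = ‖A v‖`. (This is a norm, because `A` is injective.) -/
instance : SeminormedAddCommGroup A.W := SeminormedAddCommGroup.induced A.W H A.mapW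
instance : NormedSpace ℝ A.W := NormedSpace.induced ℝ A.W H A.mapW

lemma norm_V (u : A.V) : ‖u‖ = ‖A.sqrtV u‖ := rfl
lemma norm_W (v : A.W) : ‖v‖ = ‖A.mapW v‖ := rfl

/-- The pairing `⟨A ^ β v, u⟩ = ∑_i λ_i ^ β ⟨v, e_i⟩ ⟨u, e_i⟩` for `v ∈ W` and `u ∈ V`. For
`β ≤ 3/2` the series converges absolutely, `A ^ β` maps `W` to `V'` and `V` to `W'`, and this is
both `⟨A ^ β v, u⟩_{V', V}` and `⟨A ^ β u, v⟩_{W', W}`. -/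
def coupling (β : ℝ) (v : A.W) (u : A.V) : ℝ :=
  ∑' μ : ℝ, μ ^ β * ⟪A.eigenProj μ (A.inclW v), A.eigenProj μ (A.inclV u)⟫_ℝ

lemma eigenProj_mem (μ : ℝ) (u : H) : A.eigenProj μ u ∈ A.eigenspace μ :=
  Submodule.starProjection_apply_mem _ _

lemma inner_eigenspace {μ ν : ℝ} (h : μ ≠ ν) {u v : H} (hu : u ∈ A.eigenspace μ)
    (hv : v ∈ A.eigenspace ν) : ⟪u, v⟫_ℝ = 0 := by
  obtain ⟨hu, hu'⟩ := hu
  obtain ⟨hv, hv'⟩ := hv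
  have := A.symm ⟨u, hu⟩ ⟨v, hv⟩
  rw [hu', hv', real_inner_smul_left, real_inner_smul_right] at this
  have h2 : (μ - ν) * ⟪u, v⟫_ℝ = 0 := by
    simp only at this
    linarith
  rcases mul_eq_zero.mp h2 with h3 | h3
  · exact absurd (sub_eq_zero.mp h3) h
  · exact h3

lemma inner_eigenProj_left (μ : ℝ) (x y : H) : ⟪A.eigenProj μ x, y⟫_ℝ = ⟪x, A.eigenProj μ y⟫_ℝ :=
  Submodule.inner_starProjection_left_eq_right _ _ _

lemma eigenProj_of_mem {μ : ℝ} {u : H} (hu : u ∈ A.eigenspace μ) : A.eigenProj μ u = u :=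
  Submodule.starProjection_eq_self_iff.mpr hu

lemma eigenProj_of_mem_ne {μ ν : ℝ} (h : μ ≠ ν) {u : H} (hu : u ∈ A.eigenspace ν) :
    A.eigenProj μ u = 0 := by
  have : ⟪A.eigenProj μ u, A.eigenProj μ u⟫_ℝ = 0 := by
    rw [inner_eigenProj_left, A.eigenProj_of_mem (A.eigenProj_mem μ u)]
    rw [real_inner_comm]
    exact A.inner_eigenspace h (A.eigenProj_mem μ u) hu
  exact inner_self_eq_zero.mp this

lemma eigenProj_sqrtV (μ : ℝ) (u : A.V) :
    A.eigenProj μ (A.sqrtV u) = μ ^ (1 / 2 : ℝ) • A.eigenProj μ (A.inclV u) := by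
  have h1 : A.sqrtV u = ∑' ν : ℝ, ν ^ (1 / 2 : ℝ) • A.eigenProj ν (A.inclV u) := rfl
  have h2 : Summable fun ν : ℝ => ν ^ (1 / 2 : ℝ) • A.eigenProj ν (A.inclV u) := u.2
  rw [h1, ContinuousLinearMap.map_tsum _ h2, tsum_eq_single μ]
  · rw [map_smul, A.eigenProj_of_mem (A.eigenProj_mem μ _)]
  · intro ν hν
    rw [map_smul, A.eigenProj_of_mem_ne hν.symm (A.eigenProj_mem ν _), smul_zero]

lemma eigenProj_mapW (μ : ℝ) (v : A.W) :
    A.eigenProj μ (A.mapW v) = μ • A.eigenProj μ (A.inclW v) := by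
  refine ext_inner_right ℝ fun y => ?_
  obtain ⟨h, h'⟩ := A.eigenProj_mem μ y
  have hs : ⟪A.mapW v, A.eigenProj μ y⟫_ℝ = ⟪A.inclW v, A.op ⟨_, h⟩⟫_ℝ := A.symm v ⟨_, h⟩
  rw [inner_eigenProj_left, real_inner_smul_left, inner_eigenProj_left, hs, h',
    real_inner_smul_right]

lemma sum_norm_eigenProj_sq_le (s : Finset ℝ) (x : H) :
    ∑ μ ∈ s, ‖A.eigenProj μ x‖ ^ 2 ≤ ‖x‖ ^ 2 := by
  set y := ∑ μ ∈ s, A.eigenProj μ x with hy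
  have hP : ∀ μ, ⟪A.eigenProj μ x, x⟫_ℝ = ‖A.eigenProj μ x‖ ^ 2 := fun μ => by
    rw [← real_inner_self_eq_norm_sq, inner_eigenProj_left A μ x (A.eigenProj μ x),
      A.eigenProj_of_mem (A.eigenProj_mem μ x), real_inner_comm]
  have h1 : ⟪y, x⟫_ℝ = ∑ μ ∈ s, ‖A.eigenProj μ x‖ ^ 2 := by
    rw [hy, sum_inner]
    exact Finset.sum_congr rfl fun μ _ => hP μ
  have h2 : ‖y‖ ^ 2 = ∑ μ ∈ s, ‖A.eigenProj μ x‖ ^ 2 := by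
    rw [← real_inner_self_eq_norm_sq, hy, sum_inner]
    refine Finset.sum_congr rfl fun μ hμ => ?_
    rw [inner_sum, Finset.sum_eq_single μ, real_inner_self_eq_norm_sq]
    · intro ν _ hν
      exact A.inner_eigenspace hν.symm (A.eigenProj_mem μ x) (A.eigenProj_mem ν x)
    · exact fun h => absurd hμ h
  have h3 : 0 ≤ ‖y - x‖ ^ 2 := by positivity
  rw [norm_sub_sq_real, h1, h2] at h3
  linarith

lemma sum_norm_eigenProj_mul_le (s : Finset ℝ) (x y : H) :
    ∑ μ ∈ s, ‖A.eigenProj μ x‖ * ‖A.eigenProj μ y‖ ≤ ‖x‖ * ‖y‖ := by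
  refine (Real.sum_mul_le_sqrt_mul_sqrt s _ _).trans ?_
  refine mul_le_mul ?_ ?_ (Real.sqrt_nonneg _) (norm_nonneg _)
  · exact Real.sqrt_le_iff.mpr ⟨norm_nonneg _, A.sum_norm_eigenProj_sq_le s x⟩
  · exact Real.sqrt_le_iff.mpr ⟨norm_nonneg _, A.sum_norm_eigenProj_sq_le s y⟩

lemma exists_coupling_term_le {β : ℝ} (hβ : β ≤ 3 / 2) :
    ∃ C : ℝ, 0 ≤ C ∧ ∀ (v : A.W) (u : A.V) (μ : ℝ),
      ‖μ ^ β * ⟪A.eigenProj μ (A.inclW v), A.eigenProj μ (A.inclV u)⟫_ℝ‖ ≤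
        C * (‖A.eigenProj μ (A.mapW v)‖ * ‖A.eigenProj μ (A.sqrtV u)‖) := by
  obtain ⟨a, ha, hco⟩ := A.coercive
  refine ⟨a ^ (β - 3 / 2), by positivity, fun v u μ => ?_⟩
  rcases lt_or_ge μ a with hμ | hμ
  · have h0 : A.eigenProj μ (A.inclW v) = 0 := by
      obtain ⟨h, h'⟩ := A.eigenProj_mem μ (A.inclW v)
      have h1 := hco ⟨_, h⟩
      rw [h', real_inner_smul_left] at h1
      have h2 := real_inner_self_nonneg (x := A.eigenProj μ (A.inclW v))
      have h3 : ⟪A.eigenProj μ (A.inclW v), A.eigenProj μ (A.inclW v)⟫_ℝ = 0 := by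
        simp only at h1
        nlinarith
      exact inner_self_eq_zero.mp h3
    rw [h0, inner_zero_left, mul_zero, norm_zero]
    positivity
  · have hμ0 : 0 < μ := ha.trans_le hμ
    rw [eigenProj_mapW, eigenProj_sqrtV, norm_smul, norm_smul, norm_mul,
      Real.norm_of_nonneg hμ0.le, Real.norm_of_nonneg (Real.rpow_nonneg hμ0.le _),
      Real.norm_of_nonneg (Real.rpow_nonneg hμ0.le _)]
    have h1 : μ ^ β = μ ^ (β - 3 / 2) * (μ * μ ^ (1 / 2 : ℝ)) := by
      nth_rw 3 [← Real.rpow_one μ]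
      rw [← Real.rpow_add hμ0, ← Real.rpow_add hμ0]
      congr 1
      ring
    have h2 : μ ^ (β - 3 / 2) ≤ a ^ (β - 3 / 2) :=
      Real.rpow_le_rpow_of_nonpos ha hμ (by linarith)
    have h3 := norm_inner_le_norm (𝕜 := ℝ) (A.eigenProj μ (A.inclW v)) (A.eigenProj μ (A.inclV u))
    calc μ ^ β * ‖⟪A.eigenProj μ (A.inclW v), A.eigenProj μ (A.inclV u)⟫_ℝ‖
        ≤ μ ^ β * (‖A.eigenProj μ (A.inclW v)‖ * ‖A.eigenProj μ (A.inclV u)‖) := by gcongr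
      _ = μ ^ (β - 3 / 2) * (μ * ‖A.eigenProj μ (A.inclW v)‖ *
            (μ ^ (1 / 2 : ℝ) * ‖A.eigenProj μ (A.inclV u)‖)) := by rw [h1]; ring
      _ ≤ _ := by gcongr

lemma summable_coupling {β : ℝ} (hβ : β ≤ 3 / 2) (v : A.W) (u : A.V) :
    Summable fun μ : ℝ =>
      μ ^ β * ⟪A.eigenProj μ (A.inclW v), A.eigenProj μ (A.inclV u)⟫_ℝ := by
  obtain ⟨C, -, h⟩ := A.exists_coupling_term_le hβ
  refine Summable.of_norm_bounded (Summable.mul_left C ?_) (h v u)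
  exact summable_of_sum_le (fun μ => by positivity) fun s => A.sum_norm_eigenProj_mul_le s _ _

lemma exists_coupling_le {β : ℝ} (hβ : β ≤ 3 / 2) :
    ∃ C : ℝ, 0 ≤ C ∧ ∀ (v : A.W) (u : A.V), |A.coupling β v u| ≤ C * (‖v‖ * ‖u‖) := by
  obtain ⟨C, hC, h⟩ := A.exists_coupling_term_le hβ
  refine ⟨C, hC, fun v u => ?_⟩
  have hs : Summable fun μ : ℝ => ‖A.eigenProj μ (A.mapW v)‖ * ‖A.eigenProj μ (A.sqrtV u)‖ :=
    summable_of_sum_le (fun μ => by positivity) fun s => A.sum_norm_eigenProj_mul_le s _ _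
  refine (tsum_of_norm_bounded (hs.mul_left C).hasSum (h v u)).trans ?_
  rw [tsum_mul_left, norm_W, norm_V]
  gcongr
  exact Real.tsum_le_of_sum_le (fun μ => by positivity) fun s => A.sum_norm_eigenProj_mul_le s _ _

lemma coupling_add_left {β : ℝ} (hβ : β ≤ 3 / 2) (v v' : A.W) (u : A.V) :
    A.coupling β (v + v') u = A.coupling β v u + A.coupling β v' u := by
  unfold coupling
  rw [← (A.summable_coupling hβ v u).tsum_add (A.summable_coupling hβ v' u)]
  simp only [map_add, inner_add_left, mul_add]

lemma coupling_add_right {β : ℝ} (hβ : β ≤ 3 / 2) (v : A.W) (u u' : A.V) :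
    A.coupling β v (u + u') = A.coupling β v u + A.coupling β v u' := by
  unfold coupling
  rw [← (A.summable_coupling hβ v u).tsum_add (A.summable_coupling hβ v u')]
  simp only [map_add, inner_add_right, mul_add]

lemma coupling_smul_left (β c : ℝ) (v : A.W) (u : A.V) :
    A.coupling β (c • v) u = c * A.coupling β v u := by
  unfold coupling
  rw [← tsum_mul_left]
  refine tsum_congr fun μ => ?_
  rw [map_smul, map_smul, real_inner_smul_left]
  ring

lemma coupling_smul_right (β c : ℝ) (v : A.W) (u : A.V) :
    A.coupling β v (c • u) = c * A.coupling β v u := by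
  unfold coupling
  rw [← tsum_mul_left]
  refine tsum_congr fun μ => ?_
  rw [map_smul, map_smul, real_inner_smul_right]
  ring

/-- `ℋ = V × W × H × H`, with the product topology. -/
abbrev State : Type _ := A.V × A.W × H × H

/-- `⟨Au + α A ^ β v, r⟩_{V', V}`, where `⟨Au, r⟩_{V', V} = ⟨A ^ (1/2) u, A ^ (1/2) r⟩`. -/
def formV (α β : ℝ) (u : A.V) (v : A.W) (r : A.V) : ℝ :=
  ⟪A.sqrtV u, A.sqrtV r⟫_ℝ + α * A.coupling β v r

/-- `⟨A² v + α A ^ β u, s⟩_{W', W}`, where `⟨A² v, s⟩_{W', W} = ⟨A v, A s⟩`. -/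
def formW (α β : ℝ) (u : A.V) (v : A.W) (s : A.W) : ℝ :=
  ⟪A.mapW v, A.mapW s⟫_ℝ + α * A.coupling β s u

/-- The scalar product of `ℋ`: for `U₁ = (u₁, v₁, w₁, z₁)` and `U₂ = (u₂, v₂, w₂, z₂)`,
`⟨A u₂ + α A ^ β v₂, u₁⟩_{V', V} + ⟨A² v₂ + α A ^ β u₂, v₁⟩_{W', W} + ⟨w₁, w₂⟩ + ⟨z₁, z₂⟩`. -/
def energy (α β : ℝ) (U₁ U₂ : A.State) : ℝ :=
  A.formV α β U₂.1 U₂.2.1 U₁.1 + A.formW α β U₂.1 U₂.2.1 U₁.2.1 +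
    ⟪U₁.2.2.1, U₂.2.2.1⟫_ℝ + ⟪U₁.2.2.2, U₂.2.2.2⟫_ℝ

/-- The unbounded operator
`𝒜 (u, v, w, z) = (-w, -z, A u + α A ^ β v + w, A² v + α A ^ β u)` of `ℋ`,
`D(𝒜) = {U ∈ ℋ | 𝒜 U ∈ ℋ}`, given by its graph: the pairs `(U, F) ∈ ℋ × ℋ` with `F = 𝒜 U`, where
the last two components are identities in `V'` and `W'`. With the norm of `ℋ × ℋ`, this is
also the space `D(𝒜)` with its graph norm. -/
def generator (α : ℝ) {β : ℝ} (hβ : β ≤ 3 / 2) : Submodule ℝ (A.State × A.State) where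
  carrier := {p |
    A.inclV p.2.1 = -p.1.2.2.1 ∧
    A.inclW p.2.2.1 = -p.1.2.2.2 ∧
    (∀ r : A.V, A.formV α β p.1.1 p.1.2.1 r + ⟪p.1.2.2.1, A.inclV r⟫_ℝ =
      ⟪p.2.2.2.1, A.inclV r⟫_ℝ) ∧
    (∀ s : A.W, A.formW α β p.1.1 p.1.2.1 s = ⟪p.2.2.2.2, A.inclW s⟫_ℝ)}
  add_mem' := by
    rintro p q ⟨h1, h2, h3, h4⟩ ⟨k1, k2, k3, k4⟩
    refine ⟨?_, ?_, fun r => ?_, fun s => ?_⟩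
    · simp only [Prod.fst_add, Prod.snd_add, map_add, h1, k1, neg_add]
    · simp only [Prod.fst_add, Prod.snd_add, map_add, h2, k2, neg_add]
    · have h := h3 r
      have k := k3 r
      simp only [formV, Prod.fst_add, Prod.snd_add, map_add, inner_add_left,
        A.coupling_add_left hβ] at h k ⊢
      linarith
    · have h := h4 s
      have k := k4 s
      simp only [formW, Prod.fst_add, Prod.snd_add, map_add, inner_add_left,
        A.coupling_add_right hβ] at h k ⊢
      linarith
  zero_mem' := by
    have h1 : ∀ r : A.V, A.coupling β 0 r = 0 := fun r => by
      simpa using A.coupling_smul_left β 0 0 r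
    have h2 : ∀ s : A.W, A.coupling β s 0 = 0 := fun s => by
      simpa using A.coupling_smul_right β 0 s 0
    refine ⟨?_, ?_, fun r => ?_, fun s => ?_⟩ <;> simp [formV, formW, h1, h2]
  smul_mem' := by
    rintro c p ⟨h1, h2, h3, h4⟩
    refine ⟨?_, ?_, fun r => ?_, fun s => ?_⟩
    · simp only [Prod.smul_fst, Prod.smul_snd, map_smul, h1, smul_neg]
    · simp only [Prod.smul_fst, Prod.smul_snd, map_smul, h2, smul_neg]
    · simp only [formV, Prod.smul_fst, Prod.smul_snd, map_smul, real_inner_smul_left,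
        A.coupling_smul_left, ← h3 r]
      ring
    · simp only [formW, Prod.smul_fst, Prod.smul_snd, map_smul, real_inner_smul_left,
        A.coupling_smul_right, ← h4 s]
      ring

/-- The dual space `D(𝒜)'`, with the dual norm. -/
abbrev GenDual (α : ℝ) {β : ℝ} (hβ : β ≤ 3 / 2) : Type _ := StrongDual ℝ (A.generator α hβ)

lemma exists_energy_le (α : ℝ) {β : ℝ} (hβ : β ≤ 3 / 2) :
    ∃ C : ℝ, ∀ U Φ : A.State, ‖A.energy α β U Φ‖ ≤ C * ‖U‖ * ‖Φ‖ := by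
  obtain ⟨C, hC, h⟩ := A.exists_coupling_le hβ
  refine ⟨4 + 2 * |α| * C, fun U Φ => ?_⟩
  have u1 : ‖U.1‖ ≤ ‖U‖ := norm_fst_le U
  have u2 : ‖U.2.1‖ ≤ ‖U‖ := (norm_fst_le U.2).trans (norm_snd_le U)
  have u3 : ‖U.2.2.1‖ ≤ ‖U‖ := (norm_fst_le U.2.2).trans ((norm_snd_le U.2).trans (norm_snd_le U))
  have u4 : ‖U.2.2.2‖ ≤ ‖U‖ := (norm_snd_le U.2.2).trans ((norm_snd_le U.2).trans (norm_snd_le U))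
  have p1 : ‖Φ.1‖ ≤ ‖Φ‖ := norm_fst_le Φ
  have p2 : ‖Φ.2.1‖ ≤ ‖Φ‖ := (norm_fst_le Φ.2).trans (norm_snd_le Φ)
  have p3 : ‖Φ.2.2.1‖ ≤ ‖Φ‖ := (norm_fst_le Φ.2.2).trans ((norm_snd_le Φ.2).trans (norm_snd_le Φ))
  have p4 : ‖Φ.2.2.2‖ ≤ ‖Φ‖ := (norm_snd_le Φ.2.2).trans ((norm_snd_le Φ.2).trans (norm_snd_le Φ))
  have m : ∀ {a b : ℝ}, 0 ≤ b → a ≤ ‖U‖ → b ≤ ‖Φ‖ → a * b ≤ ‖U‖ * ‖Φ‖ := fun hb h1 h2 =>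
    mul_le_mul h1 h2 hb (norm_nonneg _)
  have e1 : ‖⟪A.sqrtV Φ.1, A.sqrtV U.1⟫_ℝ‖ ≤ ‖U‖ * ‖Φ‖ := by
    refine (norm_inner_le_norm _ _).trans ?_
    rw [← norm_V, ← norm_V, mul_comm]
    exact m (norm_nonneg _) u1 p1
  have e2 : ‖⟪A.mapW Φ.2.1, A.mapW U.2.1⟫_ℝ‖ ≤ ‖U‖ * ‖Φ‖ := by
    refine (norm_inner_le_norm _ _).trans ?_
    rw [← norm_W, ← norm_W, mul_comm]
    exact m (norm_nonneg _) u2 p2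
  have e3 : ‖⟪U.2.2.1, Φ.2.2.1⟫_ℝ‖ ≤ ‖U‖ * ‖Φ‖ :=
    (norm_inner_le_norm _ _).trans (m (norm_nonneg _) u3 p3)
  have e4 : ‖⟪U.2.2.2, Φ.2.2.2⟫_ℝ‖ ≤ ‖U‖ * ‖Φ‖ :=
    (norm_inner_le_norm _ _).trans (m (norm_nonneg _) u4 p4)
  have e5 : ‖α * A.coupling β Φ.2.1 U.1‖ ≤ |α| * (C * (‖U‖ * ‖Φ‖)) := by
    rw [norm_mul, Real.norm_eq_abs, Real.norm_eq_abs]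
    have := m (norm_nonneg _) u1 p2
    rw [mul_comm] at this
    exact mul_le_mul_of_nonneg_left
      ((h _ _).trans (mul_le_mul_of_nonneg_left this hC)) (abs_nonneg _)
  have e6 : ‖α * A.coupling β U.2.1 Φ.1‖ ≤ |α| * (C * (‖U‖ * ‖Φ‖)) := by
    rw [norm_mul, Real.norm_eq_abs, Real.norm_eq_abs]
    exact mul_le_mul_of_nonneg_left
      ((h _ _).trans (mul_le_mul_of_nonneg_left (m (norm_nonneg _) u2 p1) hC)) (abs_nonneg _)
  unfold energy formV formW
  have t1 := norm_add_le (⟪A.sqrtV Φ.1, A.sqrtV U.1⟫_ℝ) (α * A.coupling β Φ.2.1 U.1)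
  have t2 := norm_add_le (⟪A.mapW Φ.2.1, A.mapW U.2.1⟫_ℝ) (α * A.coupling β U.2.1 Φ.1)
  refine (norm_add_le _ _).trans ?_
  refine (add_le_add_left (norm_add_le _ _) _).trans ?_
  refine (add_le_add_left (add_le_add_left (norm_add_le _ _) _) _).trans ?_
  nlinarith

/-- The embedding `ℋ ⊂ D(𝒜)'` given by the scalar product of the pivot space `ℋ`:
`U ↦ (Φ ↦ ⟨U, Φ⟩_ℋ)`. -/
def pivot (α : ℝ) {β : ℝ} (hβ : β ≤ 3 / 2) (U : A.State) : A.GenDual α hβ :=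
  LinearMap.mkContinuousOfExistsBound
    { toFun := fun Φ : A.generator α hβ => A.energy α β U Φ.1.1
      map_add' := fun Φ Ψ => by
        simp only [energy, formV, formW, Submodule.coe_add, Prod.fst_add, Prod.snd_add, map_add,
          inner_add_left, inner_add_right, A.coupling_add_left hβ, A.coupling_add_right hβ]
        ring
      map_smul' := fun c Φ => by
        simp only [energy, formV, formW, Submodule.coe_smul, Prod.smul_fst, Prod.smul_snd,
          map_smul, real_inner_smul_left, real_inner_smul_right, A.coupling_smul_left,
          A.coupling_smul_right, RingHom.id_apply, smul_eq_mul]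
        ring } (by
    obtain ⟨C, hC⟩ := A.exists_energy_le α hβ
    refine ⟨max (C * ‖U‖) 0, fun Φ => (hC U Φ.1.1).trans ?_⟩
    exact mul_le_mul (le_max_left _ _) (norm_fst_le Φ.1) (norm_nonneg _) (le_max_right _ _))

/-- The extension `ℋ → D(𝒜)'` of `𝒜 : D(𝒜) → ℋ ⊂ D(𝒜)'` by density, given by its graph: the closure
in `ℋ × D(𝒜)'` of the set of all pairs `(Φ, 𝒜 Φ)`, `Φ ∈ D(𝒜)`. -/
def extGenerator (α : ℝ) {β : ℝ} (hβ : β ≤ 3 / 2) : Set (A.State × A.GenDual α hβ) :=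
  closure (range fun Φ : A.generator α hβ => (Φ.1.1, A.pivot α hβ Φ.1.2))

/-- `U ∈ C([0,T]; ℋ) ∩ C¹([0,T]; D(𝒜)')` and `U' + 𝒜 U = 0` in `D(𝒜)'` on `[0,T]`. -/
def IsSolution (α : ℝ) {β : ℝ} (hβ : β ≤ 3 / 2) (T : ℝ) (U : ℝ → A.State) : Prop :=
  ContinuousOn U (Icc 0 T) ∧
  ∃ L : ℝ → A.GenDual α hβ, ContinuousOn L (Icc 0 T) ∧
    ∀ t ∈ Icc 0 T,
      HasDerivWithinAt (fun τ => A.pivot α hβ (U τ)) (L t) (Icc 0 T) t ∧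
      (U t, -L t) ∈ A.extGenerator α hβ

/-- `U = (u, v, w, z)` satisfies `w = u'` and `z = v'` in `H`, and the second order system
`u'' + u' + A u + α A ^ β v = 0` in `V'`, `v'' + A² v + α A ^ β u = 0` in `W'`, on `[0,T]`
(the two equations tested against the elements of `V` and of `W`). -/
def SolvesSystem (α β : ℝ) (T : ℝ) (U : ℝ → A.State) : Prop :=
  ∀ t ∈ Icc 0 T,
    HasDerivWithinAt (fun τ => A.inclV (U τ).1) (U t).2.2.1 (Icc 0 T) t ∧
    HasDerivWithinAt (fun τ => A.inclW (U τ).2.1) (U t).2.2.2 (Icc 0 T) t ∧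
    (∀ r : A.V, HasDerivWithinAt (fun τ => ⟪(U τ).2.2.1, A.inclV r⟫_ℝ)
      (-(⟪(U t).2.2.1, A.inclV r⟫_ℝ + A.formV α β (U t).1 (U t).2.1 r)) (Icc 0 T) t) ∧
    (∀ s : A.W, HasDerivWithinAt (fun τ => ⟪(U τ).2.2.2, A.inclW s⟫_ℝ)
      (-A.formW α β (U t).1 (U t).2.1 s) (Icc 0 T) t)

end CoerciveOp

end

namespace CoerciveOp

variable {H : Type*} [NormedAddCommGroup H] [InnerProductSpace ℝ H] [CompleteSpace H]
  (A : CoerciveOp H)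

/-! Two facts carry the theorem: `𝒜` leaves each product `E⁴` of an eigenspace `E` of `A` invariant
and acts on it as a bounded operator, and `⟨𝒜Ψ, Ψ⟩_ℋ = ‖w‖²`. The bound on `α` gives `|α| μ^β ≤ κ
μ^(3/2)` with `κ < 1` at every eigenvalue `μ`, so the energy is equivalent to the squared norm of
`ℋ` (`exists_energy_ge`).

Existence: `A` has a compact inverse, so its eigenspaces are total. Exponentials on the products
`E⁴` give classical solutions whose data are dense (`mem_closure_classical`). The energy bounds them
by their data, locally uniformly in time (`exists_norm_classicalSolution_le`), so they converge. In
`D(𝒜)'` the limit can be differentiated because the extended `𝒜` is the bounded map `U ↦ ⟨U, 𝒜*·⟩_ℋ`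
(`eq_extL_of_mem_extGenerator`).

The system: the equation is tested against elements of `D(𝒜)`. Those supported in the `w` or `z`
slot give the two second order equations. Those built from an eigenvector in the `u` and `v` slots
give `u' = w` and `v' = z` on that eigenvector, after inverting a 2×2 matrix whose determinant `μ³ -
(α μ^β)²` is nonzero by the bound on `α`. Continuity of `w` and `z` makes these derivatives strong.

Uniqueness: along an eigenvector the system is a linear ODE in `ℝ⁴`, and eigenvectors are total
(`SolvesSystem.eqOn`). -/

/-! ### Compact inverse and spectral decomposition of `A`. -/

lemma exists_norm_le_norm_op : ∃ a : ℝ, 0 < a ∧ ∀ u : A.op.domain, a * ‖(u : H)‖ ≤ ‖A.op u‖ := by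
  obtain ⟨a, ha, h⟩ := A.coercive
  refine ⟨a, ha, fun u => ?_⟩
  rcases eq_or_lt_of_le (norm_nonneg (u : H)) with h0 | h0
  · rw [← h0, mul_zero]
    exact norm_nonneg _
  · have h1 := (h u).trans (real_inner_le_norm _ _)
    rw [real_inner_self_eq_norm_mul_norm, ← mul_assoc] at h1
    exact le_of_mul_le_mul_right h1 h0

lemma mem_domain_of_forall_inner {y f : H} (h : ∀ x : A.op.domain, ⟪f, (x : H)⟫_ℝ = ⟪y, A.op x⟫_ℝ) :
    ∃ hy : y ∈ A.op.domain, A.op ⟨y, hy⟩ = f := by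
  have hs : A.op.adjoint = A.op := LinearPMap.isSelfAdjoint_def.mp A.selfAdjoint
  have h1 : y ∈ A.op.adjoint.domain := LinearPMap.mem_adjoint_domain_of_exists y ⟨f, h⟩
  have h2 := LinearPMap.adjoint_apply_eq A.dense_domain ⟨y, h1⟩ h
  -- The membership proof depends on the operator, so `A* = A` is transported through a variable
  -- `B`.
  have key : ∀ B : H →ₗ.[ℝ] H, B = A.op → ∀ k : y ∈ B.domain, B ⟨y, k⟩ = f →
      ∃ hy : y ∈ A.op.domain, A.op ⟨y, hy⟩ = f := by
    rintro B rfl k hk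
    exact ⟨k, hk⟩
  exact key _ hs h1 h2

/-- The range is closed, since `A` is closed and bounded below. A vector orthogonal to it lies in
`D(A*) = D(A)` and is killed by `A`, hence is zero. -/
lemma op_surjective (f : H) : ∃ u : A.op.domain, A.op u = f := by
  obtain ⟨a, ha, hA⟩ := A.exists_norm_le_norm_op
  have hc : IsClosed (A.op.graph : Set (H × H)) := A.selfAdjoint.isClosed
  have : CompleteSpace A.op.graph := hc.completeSpace_coe
  let g : A.op.graph →L[ℝ] H := (ContinuousLinearMap.snd ℝ H H).comp A.op.graph.subtypeL
  have hg : ∀ p : A.op.graph, ‖p‖ ≤ (max a⁻¹ 1) * ‖g p‖ := by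
    rintro ⟨⟨x, y⟩, hp⟩
    obtain ⟨u, rfl, rfl⟩ := (LinearPMap.mem_graph_iff _).mp hp
    change max ‖(u : H)‖ ‖A.op u‖ ≤ _ * ‖A.op u‖
    refine max_le ?_ ?_
    · calc ‖(u : H)‖ = a⁻¹ * (a * ‖(u : H)‖) := by field_simp
        _ ≤ a⁻¹ * ‖A.op u‖ := by gcongr; exact hA u
        _ ≤ _ := by gcongr; exact le_max_left _ _
    · calc ‖A.op u‖ = 1 * ‖A.op u‖ := (one_mul _).symm
        _ ≤ _ := by gcongr; exact le_max_right _ _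
  have hanti : AntilipschitzWith (max a⁻¹ 1).toNNReal g := by
    refine ContinuousLinearMap.antilipschitz_of_bound g fun p => ?_
    rw [Real.coe_toNNReal _ (le_max_of_le_right zero_le_one)]
    exact hg p
  have hcl : IsClosed (g.range : Set H) := by
    rw [LinearMap.coe_range]
    exact hanti.isClosed_range g.uniformContinuous
  have : CompleteSpace g.range := hcl.completeSpace_coe
  have hbot : g.rangeᗮ = ⊥ := by
    rw [Submodule.eq_bot_iff]
    intro y hy
    have hy' : ∀ x : A.op.domain, ⟪(0 : H), (x : H)⟫_ℝ = ⟪y, A.op x⟫_ℝ := fun x => by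
      rw [inner_zero_left, real_inner_comm]
      exact ((Submodule.mem_orthogonal _ _).mp hy (A.op x)
        ⟨⟨((x : H), A.op x), A.op.mem_graph x⟩, rfl⟩).symm
    obtain ⟨k, hk⟩ := A.mem_domain_of_forall_inner hy'
    have := hA ⟨y, k⟩
    rw [hk, norm_zero] at this
    exact norm_le_zero_iff.mp (nonpos_of_mul_nonpos_right this ha)
  have htop : g.range = ⊤ := (Submodule.orthogonal_eq_bot_iff).mp hbot
  obtain ⟨⟨⟨x, y⟩, hp⟩, rfl⟩ : f ∈ g.range := htop ▸ Submodule.mem_top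
  obtain ⟨u, rfl, rfl⟩ := (LinearPMap.mem_graph_iff _).mp hp
  exact ⟨u, rfl⟩

/-- The compact inverse of `A`, together with its characteristic property. -/
lemma exists_compact_inverse : ∃ K : H →L[ℝ] H, IsCompactOperator K ∧
    ∀ f, ∃ h : K f ∈ A.op.domain, A.op ⟨K f, h⟩ = f := by
  obtain ⟨a, ha, hA⟩ := A.exists_norm_le_norm_op
  have hc : IsClosed (A.op.graph : Set (H × H)) := A.selfAdjoint.isClosed
  have : CompleteSpace A.op.graph := hc.completeSpace_coe
  let g : A.op.graph →L[ℝ] H := (ContinuousLinearMap.snd ℝ H H).comp A.op.graph.subtypeL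
  have hker : g.ker = ⊥ := by
    refine LinearMap.ker_eq_bot'.mpr ?_
    rintro ⟨⟨x, y⟩, hp⟩ h0
    obtain ⟨u, rfl, rfl⟩ := (LinearPMap.mem_graph_iff _).mp hp
    have h1 : A.op u = 0 := h0
    have h2 := hA u
    rw [h1, norm_zero] at h2
    have h3 : (u : H) = 0 := norm_le_zero_iff.mp (nonpos_of_mul_nonpos_right h2 ha)
    exact Subtype.ext (Prod.ext h3 h1)
  have hrange : g.range = ⊤ := by
    refine LinearMap.range_eq_top.mpr fun f => ?_
    obtain ⟨u, hu⟩ := A.op_surjective f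
    exact ⟨⟨((u : H), A.op u), A.op.mem_graph u⟩, hu⟩
  -- By the open mapping theorem the second projection of the graph is an isomorphism onto `H`.
  -- Following its inverse by the first projection, compact by assumption, gives `A⁻¹`.
  let e := ContinuousLinearEquiv.ofBijective g hker hrange
  refine ⟨((ContinuousLinearMap.fst ℝ H H).comp A.op.graph.subtypeL).comp
    (e.symm : H →L[ℝ] A.op.graph), A.compact_injection.comp_clm (e.symm : H →L[ℝ] A.op.graph),
    fun f => ?_⟩
  have h1 : g (e.symm f) = f := ContinuousLinearEquiv.ofBijective_apply_symm_apply g hker hrange f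
  obtain ⟨u, hu, hu'⟩ := (LinearPMap.mem_graph_iff _).mp (e.symm f).2
  have h2 : (((ContinuousLinearMap.fst ℝ H H).comp A.op.graph.subtypeL).comp
    (e.symm : H →L[ℝ] A.op.graph)) f = (u : H) := hu.symm
  rw [h2]
  exact ⟨u.2, hu'.trans h1⟩

/-- The eigenspaces of `A` are total in `H`. -/
lemma eq_zero_of_forall_inner_eigenspace {h : H}
    (hh : ∀ μ, ∀ e ∈ A.eigenspace μ, ⟪h, e⟫_ℝ = 0) : h = 0 := by
  obtain ⟨K, hK, hinv⟩ := A.exists_compact_inverse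
  have hsymm : K.IsSymmetric := by
    intro x y
    obtain ⟨hx, hx'⟩ := hinv x
    obtain ⟨hy, hy'⟩ := hinv y
    have := A.symm ⟨_, hx⟩ ⟨_, hy⟩
    rw [hx', hy'] at this
    exact this.symm
  have hbot := ContinuousLinearMap.orthogonalComplement_iSup_eigenspaces_eq_bot hK hsymm
  rw [← Submodule.mem_bot ℝ, ← hbot, ← Submodule.iInf_orthogonal, Submodule.mem_iInf]
  intro ν
  rw [Submodule.mem_orthogonal]
  intro e he
  rw [Module.End.mem_eigenspace_iff] at he
  have he' : K e = ν • e := he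
  obtain ⟨k, k'⟩ := hinv e
  -- For `ν = 0`, `e = A K e = 0`; otherwise `e` is an eigenvector of `A` for `ν⁻¹`.
  rcases eq_or_ne ν 0 with rfl | hν
  · have h0 : (⟨K e, k⟩ : A.op.domain) = 0 := Subtype.ext (he'.trans (zero_smul ℝ e))
    rw [h0, A.op.map_zero] at k'
    rw [← k', inner_zero_left]
  · rw [real_inner_comm]
    have hd : e ∈ A.op.domain := by
      have := A.op.domain.smul_mem ν⁻¹ k
      rwa [he', smul_smul, inv_mul_cancel₀ hν, one_smul] at this
    refine hh ν⁻¹ e ⟨hd, ?_⟩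
    have h0 : (⟨K e, k⟩ : A.op.domain) = ν • ⟨e, hd⟩ := Subtype.ext he'
    rw [h0, A.op.map_smul] at k'
    exact (inv_smul_eq_iff₀ hν).mpr k'.symm |>.symm

lemma eq_zero_of_forall_eigenProj {h : H} (hh : ∀ μ, A.eigenProj μ h = 0) : h = 0 :=
  A.eq_zero_of_forall_inner_eigenspace fun μ e he => by
    rw [← A.eigenProj_of_mem he, ← inner_eigenProj_left, hh, inner_zero_left]

lemma orthogonalFamily_eigenspace :
    OrthogonalFamily ℝ (fun μ => A.eigenspace μ) fun μ => (A.eigenspace μ).subtypeₗᵢ :=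
  fun _ _ h x y => A.inner_eigenspace h x.2 y.2

lemma summable_norm_eigenProj_sq (h : H) : Summable fun μ => ‖A.eigenProj μ h‖ ^ 2 :=
  summable_of_sum_le (fun _ => by positivity) fun s => A.sum_norm_eigenProj_sq_le s h

lemma summable_of_mem_eigenspace {f : ℝ → H} (hf : ∀ μ, f μ ∈ A.eigenspace μ)
    (hs : Summable fun μ => ‖f μ‖ ^ 2) : Summable f :=
  (A.orthogonalFamily_eigenspace.summable_iff_norm_sq_summable fun μ => ⟨f μ, hf μ⟩).mpr hs

lemma eigenProj_tsum {f : ℝ → H} (hf : ∀ μ, f μ ∈ A.eigenspace μ) (hs : Summable f) (μ : ℝ) :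
    A.eigenProj μ (∑' ν, f ν) = f μ := by
  rw [ContinuousLinearMap.map_tsum _ hs, tsum_eq_single μ]
  · exact A.eigenProj_of_mem (hf μ)
  · exact fun ν hν => A.eigenProj_of_mem_ne hν.symm (hf ν)

lemma ext_eigenProj {x y : H} (h : ∀ μ, A.eigenProj μ x = A.eigenProj μ y) : x = y :=
  sub_eq_zero.mp (A.eq_zero_of_forall_eigenProj fun μ => by rw [map_sub, h, sub_self])

/-- The spectral decomposition of `H`. -/
lemma hasSum_eigenProj (h : H) : HasSum (fun μ => A.eigenProj μ h) h := by
  have hs := A.summable_of_mem_eigenspace (fun μ => A.eigenProj_mem μ h)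
    (A.summable_norm_eigenProj_sq h)
  convert hs.hasSum using 1
  exact A.ext_eigenProj fun μ => (A.eigenProj_tsum (fun μ => A.eigenProj_mem μ h) hs μ).symm

/-! ### Positivity of the spectrum and the condition on `α`. -/

lemma exists_pos_le_of_eigenspace_ne_bot :
    ∃ a : ℝ, 0 < a ∧ ∀ μ, ∀ e ∈ A.eigenspace μ, e ≠ 0 → a ≤ μ := by
  obtain ⟨a, ha, h⟩ := A.coercive
  refine ⟨a, ha, fun μ e ⟨he, he'⟩ h0 => ?_⟩
  have := h ⟨e, he⟩
  rw [he', real_inner_smul_left] at this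
  exact le_of_mul_le_mul_right this (real_inner_self_pos.mpr h0)

/-- Spectral sums run over all real `μ`. This dichotomy discards the indices at which the power laws
for `μ ^ s` could fail. -/
lemma eq_zero_or_pos {μ : ℝ} {e : H} (he : e ∈ A.eigenspace μ) : e = 0 ∨ 0 < μ := by
  obtain ⟨a, ha, h⟩ := A.exists_pos_le_of_eigenspace_ne_bot
  exact or_iff_not_imp_left.mpr fun h0 => ha.trans_le (h μ e he h0)

/-- The energy condition on `α` bounds the coupling on each eigenspace. -/
lemma exists_abs_mul_rpow_le {α β : ℝ} (hβ : β ≤ 3 / 2)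
    (hα : |α| < A.lambda1 ^ ((3 - 2 * β) / 2)) :
    ∃ κ : ℝ, 0 ≤ κ ∧ κ < 1 ∧ ∀ μ, ∀ e ∈ A.eigenspace μ, e ≠ 0 →
      |α| * μ ^ β ≤ κ * (μ * μ ^ (1 / 2 : ℝ)) := by
  obtain ⟨a, ha, h⟩ := A.exists_pos_le_of_eigenspace_ne_bot
  have hlow : ∀ μ ∈ {μ : ℝ | A.eigenspace μ ≠ ⊥}, a ≤ μ := by
    intro μ hμ
    obtain ⟨e, he, h0⟩ := Submodule.exists_mem_ne_zero_of_ne_bot hμ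
    exact h μ e he h0
  -- Without eigenvalues `lambda1` is only the default `sInf ∅`, but then the claim is vacuous.
  rcases Set.eq_empty_or_nonempty {μ : ℝ | A.eigenspace μ ≠ ⊥} with hE | hE
  · refine ⟨0, le_rfl, zero_lt_one, fun μ e he h0 =>
      absurd ?_ (Set.eq_empty_iff_forall_notMem.mp hE μ)⟩
    intro hb
    rw [hb, Submodule.mem_bot] at he
    exact h0 he
  · have h1 : 0 < A.lambda1 := ha.trans_le (le_csInf hE hlow)
    set p := (3 - 2 * β) / 2 with hp
    have hp0 : 0 ≤ p := by rw [hp]; linarith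
    -- With `p = 3/2 - β ≥ 0` one has `μ^(3/2) = μ^p μ^β` and `λ₁^p ≤ μ^p`.
    refine ⟨|α| / A.lambda1 ^ p, by positivity, (div_lt_one (by positivity)).mpr hα,
      fun μ e he h0 => ?_⟩
    have hle : A.lambda1 ≤ μ := csInf_le ⟨a, hlow⟩ fun hb => by
      rw [hb, Submodule.mem_bot] at he
      exact h0 he
    have hμ : 0 < μ := h1.trans_le hle
    have e1 : μ * μ ^ (1 / 2 : ℝ) = μ ^ p * μ ^ β := by
      nth_rw 1 [← Real.rpow_one μ]
      rw [← Real.rpow_add hμ, ← Real.rpow_add hμ, hp]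
      congr 1
      ring
    rw [e1, div_mul_eq_mul_div, le_div_iff₀ (by positivity)]
    have := Real.rpow_le_rpow h1.le hle hp0
    have h3 : 0 ≤ |α| * μ ^ β := by positivity
    nlinarith

/-! ### `V` and `W` as Hilbert spaces isometric to `H`. -/

lemma inclV_injective : Function.Injective A.inclV := Subtype.val_injective

lemma inclW_injective : Function.Injective A.inclW := Subtype.val_injective

lemma sqrtV_injective : Function.Injective A.sqrtV := by
  refine (injective_iff_map_eq_zero _).mpr fun u hu => A.inclV_injective ?_
  rw [map_zero]
  refine A.eq_zero_of_forall_eigenProj fun μ => ?_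
  have h := A.eigenProj_sqrtV μ u
  rw [hu, map_zero] at h
  rcases A.eq_zero_or_pos (A.eigenProj_mem μ (A.inclV u)) with h0 | h0
  · exact h0
  · exact (smul_eq_zero.mp h.symm).resolve_left (Real.rpow_pos_of_pos h0 _).ne'

lemma mapW_injective : Function.Injective A.mapW := by
  refine (injective_iff_map_eq_zero _).mpr fun v hv => A.inclW_injective ?_
  rw [map_zero]
  refine A.eq_zero_of_forall_eigenProj fun μ => ?_
  have h := A.eigenProj_mapW μ v
  rw [hv, map_zero] at h
  rcases A.eq_zero_or_pos (A.eigenProj_mem μ (A.inclW v)) with h0 | h0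
  · exact h0
  · exact (smul_eq_zero.mp h.symm).resolve_left h0.ne'

noncomputable instance : NormedAddCommGroup A.V := NormedAddCommGroup.ofSeparation fun u hu =>
  A.sqrtV_injective (by rw [map_zero]; exact norm_eq_zero.mp hu)

noncomputable instance : NormedAddCommGroup A.W := NormedAddCommGroup.ofSeparation fun v hv =>
  A.mapW_injective (by rw [map_zero]; exact norm_eq_zero.mp hv)

lemma mapW_surjective : Function.Surjective A.mapW := A.op_surjective

/-- The preimage of `x` is `∑ μ^(-1/2) P_μ x`, which converges because the eigenvalues are bounded
below by some `a > 0`. -/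
lemma sqrtV_surjective : Function.Surjective A.sqrtV := by
  intro x
  obtain ⟨a, ha, hle⟩ := A.exists_pos_le_of_eigenspace_ne_bot
  have hb : ∀ μ, ‖μ ^ (-(1 / 2) : ℝ) • A.eigenProj μ x‖ ^ 2 ≤ a⁻¹ * ‖A.eigenProj μ x‖ ^ 2 := by
    intro μ
    by_cases h0 : A.eigenProj μ x = 0
    · simp [h0]
    · have hμ := hle μ _ (A.eigenProj_mem μ x) h0
      have hμ0 := ha.trans_le hμ
      have e1 : (μ ^ (-(1 / 2) : ℝ)) ^ 2 = μ⁻¹ := by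
        rw [← Real.rpow_natCast, ← Real.rpow_mul hμ0.le, ← Real.rpow_neg_one]
        norm_num
      rw [norm_smul, mul_pow, Real.norm_eq_abs, sq_abs, e1]
      gcongr
  have hm : ∀ μ, μ ^ (-(1 / 2) : ℝ) • A.eigenProj μ x ∈ A.eigenspace μ := fun μ =>
    Submodule.smul_mem _ _ (A.eigenProj_mem μ x)
  have hs := A.summable_of_mem_eigenspace hm
    (Summable.of_nonneg_of_le (fun _ => by positivity) hb
      ((A.summable_norm_eigenProj_sq x).mul_left _))
  set y := ∑' μ : ℝ, μ ^ (-(1 / 2) : ℝ) • A.eigenProj μ x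
  have hy : ∀ μ : ℝ, μ ^ (1 / 2 : ℝ) • A.eigenProj μ y = A.eigenProj μ x := by
    intro μ
    rw [A.eigenProj_tsum hm hs]
    rcases A.eq_zero_or_pos (A.eigenProj_mem μ x) with h0 | h0
    · simp [h0]
    · rw [smul_smul, ← Real.rpow_add h0]
      norm_num
  have hyV : y ∈ (A.power (1 / 2)).domain := by
    change Summable fun μ : ℝ => μ ^ (1 / 2 : ℝ) • A.eigenProj μ y
    simp only [hy]
    exact (A.hasSum_eigenProj x).summable
  let u : A.V := ⟨y, hyV⟩
  exact ⟨u, A.ext_eigenProj fun μ => (A.eigenProj_sqrtV μ u).trans (hy μ)⟩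

lemma isometry_sqrtV : Isometry A.sqrtV :=
  AddMonoidHomClass.isometry_of_norm _ fun _ => rfl

lemma isometry_mapW : Isometry A.mapW :=
  AddMonoidHomClass.isometry_of_norm _ fun _ => rfl

instance : CompleteSpace A.V :=
  (A.isometry_sqrtV.isUniformInducing.completeSpace_congr A.sqrtV_surjective).mpr inferInstance

instance : CompleteSpace A.W :=
  (A.isometry_mapW.isUniformInducing.completeSpace_congr A.mapW_surjective).mpr inferInstance

/-! ### Coercivity of the energy. -/

/-- `|α ⟨A ^ β v, u⟩| ≤ κ ‖v‖ ‖u‖` with `κ < 1`. -/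
lemma exists_abs_coupling_le {α β : ℝ} (hβ : β ≤ 3 / 2)
    (hα : |α| < A.lambda1 ^ ((3 - 2 * β) / 2)) :
    ∃ κ : ℝ, 0 ≤ κ ∧ κ < 1 ∧ ∀ (v : A.W) (u : A.V),
      |α * A.coupling β v u| ≤ κ * (‖v‖ * ‖u‖) := by
  obtain ⟨κ, hκ0, hκ1, hκ⟩ := A.exists_abs_mul_rpow_le hβ hα
  refine ⟨κ, hκ0, hκ1, fun v u => ?_⟩
  have hs : Summable fun μ : ℝ => ‖A.eigenProj μ (A.mapW v)‖ * ‖A.eigenProj μ (A.sqrtV u)‖ :=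
    summable_of_sum_le (fun μ => by positivity) fun s => A.sum_norm_eigenProj_mul_le s _ _
  have h : ∀ μ : ℝ,
      ‖α * (μ ^ β * ⟪A.eigenProj μ (A.inclW v), A.eigenProj μ (A.inclV u)⟫_ℝ)‖ ≤
        κ * (‖A.eigenProj μ (A.mapW v)‖ * ‖A.eigenProj μ (A.sqrtV u)‖) := by
    intro μ
    by_cases h0 : A.eigenProj μ (A.inclW v) = 0
    · rw [h0, inner_zero_left, mul_zero, mul_zero, norm_zero]
      positivity
    · have hμ := (A.eq_zero_or_pos (A.eigenProj_mem μ (A.inclW v))).resolve_left h0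
      have hk := hκ μ _ (A.eigenProj_mem μ (A.inclW v)) h0
      rw [eigenProj_mapW, eigenProj_sqrtV, norm_smul, norm_smul, norm_mul, norm_mul,
        Real.norm_of_nonneg hμ.le, Real.norm_of_nonneg (Real.rpow_nonneg hμ.le _),
        Real.norm_of_nonneg (Real.rpow_nonneg hμ.le _), Real.norm_eq_abs α]
      have h3 := norm_inner_le_norm (𝕜 := ℝ) (A.eigenProj μ (A.inclW v))
        (A.eigenProj μ (A.inclV u))
      calc |α| * (μ ^ β * ‖⟪A.eigenProj μ (A.inclW v), A.eigenProj μ (A.inclV u)⟫_ℝ‖)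
          ≤ |α| * (μ ^ β * (‖A.eigenProj μ (A.inclW v)‖ * ‖A.eigenProj μ (A.inclV u)‖)) := by
            gcongr
        _ = |α| * μ ^ β * (‖A.eigenProj μ (A.inclW v)‖ * ‖A.eigenProj μ (A.inclV u)‖) := by ring
        _ ≤ κ * (μ * μ ^ (1 / 2 : ℝ)) *
            (‖A.eigenProj μ (A.inclW v)‖ * ‖A.eigenProj μ (A.inclV u)‖) := by gcongr
        _ = _ := by ring
  have h1 := tsum_of_norm_bounded (hs.mul_left κ).hasSum h
  rw [tsum_mul_left, tsum_mul_left] at h1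
  refine h1.trans ?_
  rw [norm_W, norm_V]
  gcongr
  exact Real.tsum_le_of_sum_le (fun μ => by positivity) fun s => A.sum_norm_eigenProj_mul_le s _ _

lemma energy_comm (α β : ℝ) (U Φ : A.State) : A.energy α β U Φ = A.energy α β Φ U := by
  simp only [energy, formV, formW, real_inner_comm]
  ring

/-- The energy is equivalent to the square of the norm of `ℋ`. -/
lemma exists_energy_ge {α β : ℝ} (hβ : β ≤ 3 / 2) (hα : |α| < A.lambda1 ^ ((3 - 2 * β) / 2)) :
    ∃ c : ℝ, 0 < c ∧ (∀ U : A.State, c * ‖U‖ ^ 2 ≤ A.energy α β U U) ∧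
      ∀ U : A.State, ‖U.2.2.1‖ ^ 2 ≤ A.energy α β U U := by
  obtain ⟨κ, hκ0, hκ1, h⟩ := A.exists_abs_coupling_le hβ hα
  -- The coupling enters once through each form; `2κxy ≤ κ(x² + y²)` leaves the factor `1 - κ`.
  have key : ∀ U : A.State, (1 - κ) * (‖U.1‖ ^ 2 + ‖U.2.1‖ ^ 2) + ‖U.2.2.1‖ ^ 2 + ‖U.2.2.2‖ ^ 2 ≤
      A.energy α β U U := by
    intro U
    have h1 := (abs_le.mp (h U.2.1 U.1)).1
    simp only [energy, formV, formW, real_inner_self_eq_norm_sq, ← norm_V, ← norm_W]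
    nlinarith [mul_nonneg hκ0 (sq_nonneg (‖U.1‖ - ‖U.2.1‖))]
  refine ⟨1 - κ, by linarith, fun U => le_trans ?_ (key U), fun U => le_trans ?_ (key U)⟩
  · have hk : 0 ≤ 1 - κ := by linarith
    have a1 := mul_nonneg hk (sq_nonneg ‖U.1‖)
    have a2 := mul_nonneg hk (sq_nonneg ‖U.2.1‖)
    have a3 := mul_nonneg hκ0 (sq_nonneg ‖U.2.2.1‖)
    have a4 := mul_nonneg hκ0 (sq_nonneg ‖U.2.2.2‖)
    have a5 := mul_nonneg hk (sq_nonneg ‖U.2.2.1‖)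
    have a6 := mul_nonneg hk (sq_nonneg ‖U.2.2.2‖)
    have hn : ‖U‖ = max ‖U.1‖ (max ‖U.2.1‖ (max ‖U.2.2.1‖ ‖U.2.2.2‖)) := rfl
    rcases max_choice ‖U.2.2.1‖ ‖U.2.2.2‖ with e1 | e1 <;> rw [e1] at hn <;>
    rcases max_choice ‖U.2.1‖ _ with e2 | e2 <;> rw [e2] at hn <;>
    rcases max_choice ‖U.1‖ _ with e3 | e3 <;> rw [e3] at hn <;> rw [hn] <;> nlinarith
  · have hk : 0 ≤ 1 - κ := by linarith
    nlinarith [mul_nonneg hk (sq_nonneg ‖U.1‖), mul_nonneg hk (sq_nonneg ‖U.2.1‖),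
      sq_nonneg ‖U.2.2.2‖]

/-- The scalar product of `ℋ` as a continuous bilinear form. -/
noncomputable def energyL (α : ℝ) {β : ℝ} (hβ : β ≤ 3 / 2) : A.State →L[ℝ] A.State →L[ℝ] ℝ :=
  LinearMap.mkContinuous₂ (LinearMap.mk₂ ℝ (A.energy α β)
    (fun U U' Φ => by
      simp only [energy, formV, formW, Prod.fst_add, Prod.snd_add, map_add,
        inner_add_left, inner_add_right, A.coupling_add_left hβ, A.coupling_add_right hβ]
      ring)
    (fun c U Φ => by
      simp only [energy, formV, formW, Prod.smul_fst, Prod.smul_snd,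
        map_smul, real_inner_smul_left, real_inner_smul_right, A.coupling_smul_left,
        A.coupling_smul_right, smul_eq_mul]
      ring)
    (fun U Φ Φ' => by
      simp only [energy, formV, formW, Prod.fst_add, Prod.snd_add, map_add,
        inner_add_left, inner_add_right, A.coupling_add_left hβ, A.coupling_add_right hβ]
      ring)
    (fun c U Φ => by
      simp only [energy, formV, formW, Prod.smul_fst, Prod.smul_snd,
        map_smul, real_inner_smul_left, real_inner_smul_right, A.coupling_smul_left,
        A.coupling_smul_right, smul_eq_mul]
      ring)) (A.exists_energy_le α hβ).choose
    (A.exists_energy_le α hβ).choose_spec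

lemma energyL_apply (α : ℝ) {β : ℝ} (hβ : β ≤ 3 / 2) (U Φ : A.State) :
    A.energyL α hβ U Φ = A.energy α β U Φ := rfl

end CoerciveOp

/-- The solution is `exp(tL) x`. Only completeness of the space is used, so eigenspaces need not be
known to be finite-dimensional. -/
lemma ContinuousLinearMap.exists_hasDerivAt_apply {E : Type*} [NormedAddCommGroup E]
    [NormedSpace ℝ E] [CompleteSpace E] (L : E →L[ℝ] E) (x : E) :
    ∃ y : ℝ → E, y 0 = x ∧ ∀ t, HasDerivAt y (L (y t)) t := by
  refine ⟨fun t => NormedSpace.exp (t • L) x, by simp, fun t => ?_⟩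
  exact (ContinuousLinearMap.apply ℝ E x).hasFDerivAt.comp_hasDerivAt t
    (hasDerivAt_exp_smul_const' (𝕂 := ℝ) L t)

namespace CoerciveOp

variable {H : Type*} [NormedAddCommGroup H] [InnerProductSpace ℝ H] [CompleteSpace H]
  (A : CoerciveOp H)

/-! ### Eigenvectors as test functions, and the invariant modes of `𝒜`. -/

lemma eigenspace_le_domain_power (s μ : ℝ) : A.eigenspace μ ≤ (A.power s).domain := by
  intro e he
  refine summable_of_ne_finset_zero (s := {μ}) fun ν hν => ?_
  rw [A.eigenProj_of_mem_ne (by simpa using hν) he, smul_zero]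

lemma eigenspace_le_domain (μ : ℝ) : A.eigenspace μ ≤ A.op.domain := fun _ he => he.1

/-- The inclusion of an eigenspace in `V`, as a linear map. -/
noncomputable def eigenVₗ (μ : ℝ) : A.eigenspace μ →ₗ[ℝ] A.V :=
  Submodule.inclusion (A.eigenspace_le_domain_power (1 / 2) μ)

/-- The inclusion of an eigenspace in `W`, as a linear map. -/
noncomputable def eigenWₗ (μ : ℝ) : A.eigenspace μ →ₗ[ℝ] A.W :=
  Submodule.inclusion (A.eigenspace_le_domain μ)

lemma sqrtV_eigenVₗ {μ : ℝ} (e : A.eigenspace μ) :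
    A.sqrtV (A.eigenVₗ μ e) = μ ^ (1 / 2 : ℝ) • (e : H) := by
  refine A.ext_eigenProj fun ν => ?_
  rw [A.eigenProj_sqrtV, map_smul]
  have h : A.inclV (A.eigenVₗ μ e) = e := rfl
  rw [h]
  rcases eq_or_ne ν μ with rfl | hν
  · rfl
  · rw [A.eigenProj_of_mem_ne hν e.2, smul_zero, smul_zero]

lemma mapW_eigenWₗ {μ : ℝ} (e : A.eigenspace μ) : A.mapW (A.eigenWₗ μ e) = μ • (e : H) :=
  e.2.2

/-- The inclusion of an eigenspace in `V`. -/
noncomputable def eigenV (μ : ℝ) : A.eigenspace μ →L[ℝ] A.V :=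
  (A.eigenVₗ μ).mkContinuous ‖μ ^ (1 / 2 : ℝ)‖ fun e => by
    rw [norm_V, A.sqrtV_eigenVₗ, norm_smul, Submodule.coe_norm]

/-- The inclusion of an eigenspace in `W`. -/
noncomputable def eigenW (μ : ℝ) : A.eigenspace μ →L[ℝ] A.W :=
  (A.eigenWₗ μ).mkContinuous ‖μ‖ fun e => by
    rw [norm_W, A.mapW_eigenWₗ, norm_smul, Submodule.coe_norm]

lemma sqrtV_eigenV {μ : ℝ} (e : A.eigenspace μ) :
    A.sqrtV (A.eigenV μ e) = μ ^ (1 / 2 : ℝ) • (e : H) := A.sqrtV_eigenVₗ e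

lemma mapW_eigenW {μ : ℝ} (e : A.eigenspace μ) : A.mapW (A.eigenW μ e) = μ • (e : H) :=
  A.mapW_eigenWₗ e

@[simp] lemma inclV_eigenV {μ : ℝ} (e : A.eigenspace μ) : A.inclV (A.eigenV μ e) = e := rfl

@[simp] lemma inclW_eigenW {μ : ℝ} (e : A.eigenspace μ) : A.inclW (A.eigenW μ e) = e := rfl

lemma inner_eigenProj_coe {μ : ℝ} (x : H) (e : A.eigenspace μ) :
    ⟪A.eigenProj μ x, (e : H)⟫_ℝ = ⟪x, (e : H)⟫_ℝ := by
  rw [inner_eigenProj_left, A.eigenProj_of_mem e.2]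

/-- Against an eigenvector only the `μ`-component of the other argument survives. This and the next
lemmas turn both forms into scalar expressions in coordinates. -/
lemma inner_sqrtV_eigenV {μ : ℝ} (u : A.V) (e : A.eigenspace μ) :
    ⟪A.sqrtV u, A.sqrtV (A.eigenV μ e)⟫_ℝ = μ * ⟪A.inclV u, (e : H)⟫_ℝ := by
  rw [sqrtV_eigenV, real_inner_smul_right, ← inner_eigenProj_coe, eigenProj_sqrtV,
    real_inner_smul_left, inner_eigenProj_coe, ← mul_assoc]
  rcases A.eq_zero_or_pos e.2 with h | h
  · rw [h, inner_zero_right, mul_zero, mul_zero]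
  · rw [← Real.rpow_add h]
    norm_num

lemma inner_mapW_eigenW {μ : ℝ} (v : A.W) (e : A.eigenspace μ) :
    ⟪A.mapW v, A.mapW (A.eigenW μ e)⟫_ℝ = μ ^ 2 * ⟪A.inclW v, (e : H)⟫_ℝ := by
  rw [mapW_eigenW, real_inner_smul_right, ← inner_eigenProj_coe, eigenProj_mapW,
    real_inner_smul_left, inner_eigenProj_coe]
  ring

lemma coupling_eigenV (β : ℝ) {μ : ℝ} (v : A.W) (e : A.eigenspace μ) :
    A.coupling β v (A.eigenV μ e) = μ ^ β * ⟪A.inclW v, (e : H)⟫_ℝ := by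
  rw [coupling, tsum_eq_single μ]
  · rw [inclV_eigenV, A.eigenProj_of_mem e.2, inner_eigenProj_coe]
  · intro ν hν
    rw [inclV_eigenV, A.eigenProj_of_mem_ne hν e.2, inner_zero_right, mul_zero]

lemma coupling_eigenW (β : ℝ) {μ : ℝ} (e : A.eigenspace μ) (u : A.V) :
    A.coupling β (A.eigenW μ e) u = μ ^ β * ⟪(e : H), A.inclV u⟫_ℝ := by
  rw [coupling, tsum_eq_single μ]
  · rw [inclW_eigenW, A.eigenProj_of_mem e.2, real_inner_comm, inner_eigenProj_coe,
      real_inner_comm]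
  · intro ν hν
    rw [inclW_eigenW, A.eigenProj_of_mem_ne hν e.2, inner_zero_left, mul_zero]

lemma formV_eigenV (α β : ℝ) {μ : ℝ} (u : A.V) (v : A.W) (e : A.eigenspace μ) :
    A.formV α β u v (A.eigenV μ e) =
      μ * ⟪A.inclV u, (e : H)⟫_ℝ + α * μ ^ β * ⟪A.inclW v, (e : H)⟫_ℝ := by
  rw [formV, inner_sqrtV_eigenV, coupling_eigenV, mul_assoc]

lemma formW_eigenW (α β : ℝ) {μ : ℝ} (u : A.V) (v : A.W) (e : A.eigenspace μ) :
    A.formW α β u v (A.eigenW μ e) =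
      μ ^ 2 * ⟪A.inclW v, (e : H)⟫_ℝ + α * μ ^ β * ⟪A.inclV u, (e : H)⟫_ℝ := by
  rw [formW, inner_mapW_eigenW, coupling_eigenW, mul_assoc, real_inner_comm (A.inclV u)]

/-- The states with components in the eigenspace of `μ`. -/
abbrev Mode (μ : ℝ) : Type _ :=
  A.eigenspace μ × A.eigenspace μ × A.eigenspace μ × A.eigenspace μ

/-- The inclusion of the modes in `ℋ`. -/
noncomputable def modeState (μ : ℝ) : A.Mode μ →L[ℝ] A.State :=
  (A.eigenV μ).prodMap ((A.eigenW μ).prodMap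
    ((A.eigenspace μ).subtypeL.prodMap (A.eigenspace μ).subtypeL))

lemma modeState_apply {μ : ℝ} (y : A.Mode μ) :
    A.modeState μ y = (A.eigenV μ y.1, A.eigenW μ y.2.1, (y.2.2.1 : H), (y.2.2.2 : H)) := rfl

/-- The restriction of `𝒜` to the states with components in the eigenspace of `μ`. -/
noncomputable def modeGenerator (α β μ : ℝ) : A.Mode μ →L[ℝ] A.Mode μ :=
  let E := A.eigenspace μ
  let p₁ : A.Mode μ →L[ℝ] E := .fst ℝ E (E × E × E)
  let p₂ : A.Mode μ →L[ℝ] E := (ContinuousLinearMap.fst ℝ E (E × E)).comp (.snd ℝ E (E × E × E))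
  let q : A.Mode μ →L[ℝ] E × E :=
    (ContinuousLinearMap.snd ℝ E (E × E)).comp (.snd ℝ E (E × E × E))
  let p₃ : A.Mode μ →L[ℝ] E := (ContinuousLinearMap.fst ℝ E E).comp q
  let p₄ : A.Mode μ →L[ℝ] E := (ContinuousLinearMap.snd ℝ E E).comp q
  (-p₃).prod ((-p₄).prod ((μ • p₁ + (α * μ ^ β) • p₂ + p₃).prod (μ ^ 2 • p₂ + (α * μ ^ β) • p₁)))

lemma modeGenerator_apply (α β : ℝ) {μ : ℝ} (y : A.Mode μ) :
    A.modeGenerator α β μ y = (-y.2.2.1, -y.2.2.2, μ • y.1 + (α * μ ^ β) • y.2.1 + y.2.2.1,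
      μ ^ 2 • y.2.1 + (α * μ ^ β) • y.1) := rfl

lemma modeState_mem_generator (α : ℝ) {β : ℝ} (hβ : β ≤ 3 / 2) {μ : ℝ} (y : A.Mode μ) :
    (A.modeState μ y, A.modeState μ (A.modeGenerator α β μ y)) ∈ A.generator α hβ := by
  refine ⟨?_, ?_, fun r => ?_, fun s => ?_⟩
  · rfl
  · rfl
  · simp only [modeState_apply, modeGenerator_apply, formV]
    rw [real_inner_comm, inner_sqrtV_eigenV, coupling_eigenW, real_inner_comm (y.1 : H)]
    simp only [Submodule.coe_add, Submodule.coe_smul, inner_add_left, real_inner_smul_left]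
    ring
  · simp only [modeState_apply, modeGenerator_apply, formW]
    rw [real_inner_comm, inner_mapW_eigenW, coupling_eigenV, real_inner_comm (y.2.1 : H),
      real_inner_comm (y.1 : H)]
    simp only [Submodule.coe_add, Submodule.coe_smul, inner_add_left, real_inner_smul_left]
    ring

/-! ### Classical solutions and the density of their data. -/

/-- `Y` is a classical solution of `Y' + 𝒜 Y = 0` on `ℝ`. -/
def IsClassicalSolution (α : ℝ) {β : ℝ} (hβ : β ≤ 3 / 2) (Y : ℝ → A.State) : Prop :=
  ∃ Z : ℝ → A.State, ∀ t, HasDerivAt Y (-Z t) t ∧ (Y t, Z t) ∈ A.generator α hβ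

variable {A}

lemma IsClassicalSolution.add {α β : ℝ} {hβ : β ≤ 3 / 2} {Y Y' : ℝ → A.State}
    (h : A.IsClassicalSolution α hβ Y) (h' : A.IsClassicalSolution α hβ Y') :
    A.IsClassicalSolution α hβ (Y + Y') := by
  obtain ⟨Z, hZ⟩ := h
  obtain ⟨Z', hZ'⟩ := h'
  refine ⟨Z + Z', fun t => ⟨?_, ?_⟩⟩
  · rw [Pi.add_apply, neg_add]
    exact (hZ t).1.add (hZ' t).1
  · exact (A.generator α hβ).add_mem (hZ t).2 (hZ' t).2

lemma IsClassicalSolution.sub {α β : ℝ} {hβ : β ≤ 3 / 2} {Y Y' : ℝ → A.State}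
    (h : A.IsClassicalSolution α hβ Y) (h' : A.IsClassicalSolution α hβ Y') :
    A.IsClassicalSolution α hβ (Y - Y') := by
  obtain ⟨Z, hZ⟩ := h
  obtain ⟨Z', hZ'⟩ := h'
  refine ⟨Z - Z', fun t => ⟨?_, ?_⟩⟩
  · rw [Pi.sub_apply, neg_sub']
    exact (hZ t).1.sub (hZ' t).1
  · exact (A.generator α hβ).sub_mem (hZ t).2 (hZ' t).2

variable (A)

lemma isClassicalSolution_zero (α : ℝ) {β : ℝ} (hβ : β ≤ 3 / 2) :
    A.IsClassicalSolution α hβ 0 :=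
  ⟨0, fun t => ⟨by rw [Pi.zero_apply, neg_zero]; exact hasDerivAt_const t 0, zero_mem _⟩⟩

lemma exists_isClassicalSolution_mode (α : ℝ) {β : ℝ} (hβ : β ≤ 3 / 2) {μ : ℝ} (y : A.Mode μ) :
    ∃ Y : ℝ → A.State, A.IsClassicalSolution α hβ Y ∧ Y 0 = A.modeState μ y := by
  obtain ⟨Y, hY0, hY⟩ := (-A.modeGenerator α β μ).exists_hasDerivAt_apply y
  refine ⟨fun t => A.modeState μ (Y t),
    ⟨fun t => A.modeState μ (A.modeGenerator α β μ (Y t)), fun t => ⟨?_, ?_⟩⟩, ?_⟩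
  · rw [← map_neg]
    exact (A.modeState μ).hasFDerivAt.comp_hasDerivAt t (hY t)
  · exact A.modeState_mem_generator α hβ (Y t)
  · simp only [hY0]

/-- The data of classical solutions are dense in `ℋ`. -/
lemma mem_closure_classical (α : ℝ) {β : ℝ} (hβ : β ≤ 3 / 2) (U₀ : A.State) :
    U₀ ∈ closure {U : A.State | ∃ Y, A.IsClassicalSolution α hβ Y ∧ Y 0 = U} := by
  let y : ∀ μ, A.Mode μ := fun μ =>
    (⟨_, A.eigenProj_mem μ (A.inclV U₀.1)⟩, ⟨_, A.eigenProj_mem μ (A.inclW U₀.2.1)⟩,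
      ⟨_, A.eigenProj_mem μ U₀.2.2.1⟩, ⟨_, A.eigenProj_mem μ U₀.2.2.2⟩)
  have h1 : HasSum (fun μ => A.eigenV μ (y μ).1) U₀.1 := by
    -- Convergence in `V` is tested in `H` after `A^(1/2)`, where the series becomes the spectral
    -- decomposition of `A^(1/2) u`.
    rw [← A.isometry_sqrtV.isUniformInducing.isInducing.hasSum_iff (g := A.sqrtV)]
    have : (A.sqrtV ∘ fun μ => A.eigenV μ (y μ).1) = fun μ => A.eigenProj μ (A.sqrtV U₀.1) := by
      funext μ
      rw [eigenProj_sqrtV]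
      exact A.sqrtV_eigenV _
    rw [this]
    exact A.hasSum_eigenProj _
  have h2 : HasSum (fun μ => A.eigenW μ (y μ).2.1) U₀.2.1 := by
    rw [← A.isometry_mapW.isUniformInducing.isInducing.hasSum_iff (g := A.mapW)]
    have : (A.mapW ∘ fun μ => A.eigenW μ (y μ).2.1) = fun μ => A.eigenProj μ (A.mapW U₀.2.1) := by
      funext μ
      rw [eigenProj_mapW]
      exact A.mapW_eigenW _
    rw [this]
    exact A.hasSum_eigenProj _
  have h : HasSum (fun μ => A.modeState μ (y μ)) U₀ :=
    h1.prodMk (h2.prodMk ((A.hasSum_eigenProj U₀.2.2.1).prodMk (A.hasSum_eigenProj U₀.2.2.2)))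
  refine mem_closure_of_tendsto h (Eventually.of_forall fun s => ?_)
  choose Y hY hY0 using fun μ => A.exists_isClassicalSolution_mode α hβ (y μ)
  refine ⟨∑ μ ∈ s, Y μ, ?_, ?_⟩
  · exact Finset.sum_induction _ (A.IsClassicalSolution α hβ) (fun _ _ => .add)
      (A.isClassicalSolution_zero α hβ) fun μ _ => hY μ
  · rw [Finset.sum_apply]
    exact Finset.sum_congr rfl fun μ _ => hY0 μ

/-! ### The adjoint of `𝒜` and the extension to `D(𝒜)'`. -/

noncomputable instance (α : ℝ) {β : ℝ} (hβ : β ≤ 3 / 2) : NormedAddCommGroup (A.GenDual α hβ) :=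
  ContinuousLinearMap.toNormedAddCommGroup

noncomputable instance (α : ℝ) {β : ℝ} (hβ : β ≤ 3 / 2) : NormedSpace ℝ (A.GenDual α hβ) :=
  ContinuousLinearMap.toNormedSpace

/-- The adjoint of `𝒜` in `ℋ` has the domain of `𝒜` and
`𝒜* (u, v, w, z) = -𝒜 (u, v, w, z) + (0, 0, 2 w, 0)`. -/
noncomputable def adjointGenerator (α : ℝ) {β : ℝ} (hβ : β ≤ 3 / 2) :
    A.generator α hβ →L[ℝ] A.State :=
  let w : A.State →L[ℝ] H := (ContinuousLinearMap.fst ℝ H H).comp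
    ((ContinuousLinearMap.snd ℝ A.W (H × H)).comp (.snd ℝ A.V (A.W × H × H)))
  let k : A.State →L[ℝ] A.State :=
    ContinuousLinearMap.prod 0 (ContinuousLinearMap.prod 0 (((2 : ℝ) • w).prod 0))
  (k.comp (.fst ℝ A.State A.State) - .snd ℝ A.State A.State).comp (A.generator α hβ).subtypeL

lemma adjointGenerator_apply (α : ℝ) {β : ℝ} (hβ : β ≤ 3 / 2) (Φ : A.generator α hβ) :
    A.adjointGenerator α hβ Φ = ((0, 0, (2 : ℝ) • Φ.1.1.2.2.1, 0) : A.State) - Φ.1.2 := rfl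

/-- The embedding `ℋ ⊂ D(𝒜)'` as a continuous linear map. -/
noncomputable def pivotL (α : ℝ) {β : ℝ} (hβ : β ≤ 3 / 2) : A.State →L[ℝ] A.GenDual α hβ :=
  ((ContinuousLinearMap.compL ℝ (A.generator α hβ) A.State ℝ).flip
    ((ContinuousLinearMap.fst ℝ A.State A.State).comp (A.generator α hβ).subtypeL)).comp
    (A.energyL α hβ)

lemma pivotL_apply (α : ℝ) {β : ℝ} (hβ : β ≤ 3 / 2) (U : A.State) :
    A.pivotL α hβ U = A.pivot α hβ U := rfl

/-- The extension `ℋ → D(𝒜)'` of `𝒜`: `U ↦ (Φ ↦ ⟨U, 𝒜* Φ⟩_ℋ)`. -/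
noncomputable def extL (α : ℝ) {β : ℝ} (hβ : β ≤ 3 / 2) : A.State →L[ℝ] A.GenDual α hβ :=
  ((ContinuousLinearMap.compL ℝ (A.generator α hβ) A.State ℝ).flip
    (A.adjointGenerator α hβ)).comp (A.energyL α hβ)

lemma extL_apply (α : ℝ) {β : ℝ} (hβ : β ≤ 3 / 2) (U : A.State) (Φ : A.generator α hβ) :
    A.extL α hβ U Φ = A.energy α β U (A.adjointGenerator α hβ Φ) := rfl

lemma energy_adjointGenerator (α : ℝ) {β : ℝ} (hβ : β ≤ 3 / 2) (U : A.State)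
    (Φ : A.generator α hβ) : A.energy α β U (A.adjointGenerator α hβ Φ) =
      2 * ⟪U.2.2.1, Φ.1.1.2.2.1⟫_ℝ - A.energy α β U Φ.1.2 := by
  have h : A.energy α β U (0, 0, (2 : ℝ) • Φ.1.1.2.2.1, 0) = 2 * ⟪U.2.2.1, Φ.1.1.2.2.1⟫_ℝ := by
    rw [energy_comm]
    have h1 : A.coupling β U.2.1 0 = 0 := by simpa using A.coupling_smul_right β 0 U.2.1 0
    have h2 : A.coupling β 0 U.1 = 0 := by simpa using A.coupling_smul_left β 0 0 U.1
    simp only [energy, formV, formW, map_zero, inner_zero_left, inner_zero_right, h1, h2, mul_zero,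
      add_zero, zero_add, real_inner_smul_left]
    rw [real_inner_comm]
  rw [← h, adjointGenerator_apply, ← energyL_apply A α hβ, map_sub, energyL_apply, energyL_apply]

/-- `⟨𝒜 Ψ, Φ⟩_ℋ = ⟨Ψ, 𝒜* Φ⟩_ℋ`. -/
lemma energy_generator (α : ℝ) {β : ℝ} (hβ : β ≤ 3 / 2) (Ψ Φ : A.generator α hβ) :
    A.energy α β Ψ.1.2 Φ.1.1 = A.energy α β Ψ.1.1 (A.adjointGenerator α hβ Φ) := by
  rw [energy_adjointGenerator, A.energy_comm α β Ψ.1.1]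
  obtain ⟨⟨Ψ, Ψ'⟩, a1, a2, a3, a4⟩ := Ψ
  obtain ⟨⟨Φ, Φ'⟩, b1, b2, b3, b4⟩ := Φ
  -- The `V'` and `W'` identities of each element are tested with the `V` and `W` components of the
  -- image of the other.
  have c1 := a3 Φ'.1
  have c2 := a4 Φ'.2.1
  have c3 := b3 Ψ'.1
  have c4 := b4 Ψ'.2.1
  simp only at a1 a2 b1 b2 c1 c2 c3 c4
  rw [b1, inner_neg_right, inner_neg_right] at c1
  rw [b2, inner_neg_right] at c2
  rw [a1, inner_neg_right, inner_neg_right] at c3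
  rw [a2, inner_neg_right] at c4
  simp only [energy]
  rw [real_inner_comm Ψ.2.2.1 Φ.2.2.1] at c3
  rw [real_inner_comm Ψ.2.2.1 Φ'.2.2.1] at c3
  rw [real_inner_comm Ψ.2.2.2 Φ'.2.2.2] at c4
  rw [real_inner_comm Ψ.2.2.1 Φ'.2.2.1, real_inner_comm Ψ.2.2.2 Φ'.2.2.2]
  linarith

lemma pivot_generator (α : ℝ) {β : ℝ} (hβ : β ≤ 3 / 2) (Ψ : A.generator α hβ) :
    A.pivot α hβ Ψ.1.2 = A.extL α hβ Ψ.1.1 :=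
  ContinuousLinearMap.ext fun Φ => A.energy_generator α hβ Ψ Φ

/-- The graph of the continuous map `extL` is closed and contains the pairs `(Ψ, 𝒜Ψ)`, hence their
closure. In particular the closure is single-valued. -/
lemma eq_extL_of_mem_extGenerator {α β : ℝ} {hβ : β ≤ 3 / 2} {U : A.State} {L : A.GenDual α hβ}
    (h : (U, L) ∈ A.extGenerator α hβ) : L = A.extL α hβ U := by
  have hc : IsClosed {p : A.State × A.GenDual α hβ | p.2 = A.extL α hβ p.1} :=
    isClosed_eq continuous_snd ((A.extL α hβ).continuous.comp continuous_fst)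
  refine closure_minimal ?_ hc h
  rintro _ ⟨Ψ, rfl⟩
  exact A.pivot_generator α hβ Ψ

/-! ### Energy estimate and existence. -/

/-- The energy is dissipated: `⟨𝒜 Ψ, Ψ⟩_ℋ = ‖w‖²`. -/
lemma energy_generator_self (α : ℝ) {β : ℝ} (hβ : β ≤ 3 / 2) (Ψ : A.generator α hβ) :
    A.energy α β Ψ.1.2 Ψ.1.1 = ‖Ψ.1.1.2.2.1‖ ^ 2 := by
  have h := A.energy_generator α hβ Ψ Ψ
  rw [energy_adjointGenerator, A.energy_comm α β Ψ.1.1, real_inner_self_eq_norm_sq] at h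
  linarith

lemma IsClassicalSolution.hasDerivAt_energy {α β : ℝ} {hβ : β ≤ 3 / 2} {Y : ℝ → A.State}
    (h : A.IsClassicalSolution α hβ Y) (t : ℝ) :
    HasDerivAt (fun τ => A.energy α β (Y τ) (Y τ)) (-2 * ‖(Y t).2.2.1‖ ^ 2) t := by
  obtain ⟨Z, hZ⟩ := h
  obtain ⟨h1, h2⟩ := hZ t
  have h3 := (A.energyL α hβ).hasDerivAt_of_bilinear (fun _ => h1) (fun _ => h1)
  have h4 := A.energy_generator_self α hβ ⟨_, h2⟩
  have h5 := A.energy_comm α β (Y t) (Z t)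
  refine h3.congr_deriv ?_
  rw [map_neg, map_neg, neg_apply, energyL_apply, energyL_apply]
  simp only at h4
  linarith

/-- Forward in time the energy `E` decreases. Backward, `E' = -2‖w‖² ≥ -2E` makes `e^(2t) E`
nondecreasing. Negative times let the limit be differentiated on an open interval around `[0,T]`. -/
lemma exists_norm_classicalSolution_le {α β : ℝ} (hβ : β ≤ 3 / 2)
    (hα : |α| < A.lambda1 ^ ((3 - 2 * β) / 2)) :
    ∃ C : ℝ, 0 ≤ C ∧ ∀ Y, A.IsClassicalSolution α hβ Y →
      ∀ t, ‖Y t‖ ≤ C * Real.exp |t| * ‖Y 0‖ := by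
  obtain ⟨c, hc, hlow, hw⟩ := A.exists_energy_ge hβ hα
  obtain ⟨C, hC⟩ := A.exists_energy_le α hβ
  refine ⟨√(|C| / c), Real.sqrt_nonneg _, fun Y hY t => ?_⟩
  have hd := hY.hasDerivAt_energy
  have hE : A.energy α β (Y t) (Y t) ≤ Real.exp |t| ^ 2 * A.energy α β (Y 0) (Y 0) := by
    have hE0 : 0 ≤ A.energy α β (Y 0) (Y 0) := (by positivity : (0 : ℝ) ≤ _).trans (hw (Y 0))
    rcases le_total 0 t with ht | ht
    · have hanti := antitone_of_hasDerivAt_nonpos hd fun s => by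
        have := sq_nonneg ‖(Y s).2.2.1‖
        simp only [Pi.zero_apply]
        linarith
      refine (hanti ht).trans (le_mul_of_one_le_left hE0 ?_)
      exact one_le_pow₀ (Real.one_le_exp (abs_nonneg t))
    · have hd2 : ∀ s, HasDerivAt (fun τ => Real.exp (2 * τ) * A.energy α β (Y τ) (Y τ))
          (Real.exp (2 * s) * (2 * (A.energy α β (Y s) (Y s) - ‖(Y s).2.2.1‖ ^ 2))) s := by
        intro s
        have h1 : HasDerivAt (fun τ : ℝ => Real.exp (2 * τ)) (Real.exp (2 * s) * 2) s := by
          simpa using ((hasDerivAt_id s).const_mul 2).exp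
        exact (h1.mul (hd s)).congr_deriv (by ring)
      have hmono := monotone_of_hasDerivAt_nonneg hd2 fun s =>
        mul_nonneg (Real.exp_pos _).le (mul_nonneg zero_le_two (sub_nonneg.mpr (hw (Y s))))
      have h1 := hmono ht
      simp only [mul_zero, Real.exp_zero, one_mul] at h1
      have h2 : Real.exp |t| ^ 2 * Real.exp (2 * t) = 1 := by
        rw [abs_of_nonpos ht, ← Real.exp_nat_mul, ← Real.exp_add, ← Real.exp_zero]
        congr 1
        push_cast
        ring
      calc A.energy α β (Y t) (Y t)
          = Real.exp |t| ^ 2 * (Real.exp (2 * t) * A.energy α β (Y t) (Y t)) := by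
            rw [← mul_assoc, h2, one_mul]
        _ ≤ _ := by gcongr
  have h0 : A.energy α β (Y 0) (Y 0) ≤ |C| * ‖Y 0‖ ^ 2 := by
    refine (le_abs_self _).trans ((hC (Y 0) (Y 0)).trans ?_)
    rw [mul_assoc, ← sq]
    gcongr
    exact le_abs_self C
  refine (pow_le_pow_iff_left₀ (norm_nonneg _) (by positivity) two_ne_zero).mp ?_
  rw [mul_pow, mul_pow, Real.sq_sqrt (by positivity)]
  have h1 : c * ‖Y t‖ ^ 2 ≤ Real.exp |t| ^ 2 * (|C| * ‖Y 0‖ ^ 2) :=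
    (hlow (Y t)).trans (hE.trans (by gcongr))
  calc ‖Y t‖ ^ 2 = c * ‖Y t‖ ^ 2 / c := by field_simp
    _ ≤ Real.exp |t| ^ 2 * (|C| * ‖Y 0‖ ^ 2) / c := by gcongr
    _ = _ := by ring

lemma exists_isSolution {α β : ℝ} (hβ : β ≤ 3 / 2)
    (hα : |α| < A.lambda1 ^ ((3 - 2 * β) / 2)) (T : ℝ) (U₀ : A.State) :
    ∃ U : ℝ → A.State, A.IsSolution α hβ T U ∧ U 0 = U₀ := by
  obtain ⟨C, hC0, hC⟩ := A.exists_norm_classicalSolution_le hβ hα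
  obtain ⟨x, hx, hlim⟩ := mem_closure_iff_seq_limit.mp (A.mem_closure_classical α hβ U₀)
  choose Y hY hY0 using hx
  have hlim0 : Tendsto (fun n => Y n 0) atTop (𝓝 U₀) := by simpa only [hY0] using hlim
  have hcau : ∀ R : ℝ, UniformCauchySeqOn Y atTop (Metric.ball 0 R) := by
    intro R
    rw [Metric.uniformCauchySeqOn_iff]
    intro ε hε
    -- The summand 1 keeps `M` positive when `C = 0`.
    set M := C * Real.exp R + 1 with hM
    have hM0 : 0 < M := by positivity
    obtain ⟨N, hN⟩ := Metric.cauchySeq_iff.mp hlim0.cauchySeq (ε / M) (by positivity)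
    refine ⟨N, fun m hm n hn t ht => ?_⟩
    have h1 := hC _ ((hY m).sub (hY n)) t
    have h2 := hN m hm n hn
    rw [dist_eq_norm] at h2 ⊢
    rw [Metric.mem_ball, dist_zero_right, Real.norm_eq_abs] at ht
    calc ‖Y m t - Y n t‖ ≤ C * Real.exp |t| * ‖Y m 0 - Y n 0‖ := h1
      _ ≤ M * ‖Y m 0 - Y n 0‖ := by
        gcongr
        rw [hM]
        have := mul_le_mul_of_nonneg_left (Real.exp_le_exp.mpr ht.le) hC0
        linarith
      _ < M * (ε / M) := by gcongr
      _ = ε := by field_simp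
  have hpt : ∀ t, ∃ y, Tendsto (fun n => Y n t) atTop (𝓝 y) := fun t =>
    cauchySeq_tendsto_of_complete <| (hcau (|t| + 1)).cauchySeq <| by
      rw [Metric.mem_ball, dist_zero_right, Real.norm_eq_abs]
      linarith
  choose U hU using hpt
  set S : Set ℝ := Metric.ball 0 (|T| + 1)
  have hS : Icc 0 T ⊆ S := fun t ht => by
    rw [Metric.mem_ball, dist_zero_right, Real.norm_eq_abs, abs_of_nonneg ht.1]
    linarith [ht.2, le_abs_self T]
  have hunif : TendstoUniformlyOn Y U atTop S :=
    (hcau _).tendstoUniformlyOn_of_tendsto fun t _ => hU t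
  have hcont : ContinuousOn U S := hunif.continuousOn <| Frequently.of_forall fun n t _ => by
    obtain ⟨Z, hZ⟩ := hY n
    exact (hZ t).1.continuousAt.continuousWithinAt
  -- In `D(𝒜)'` the derivative is a bounded function of `Y n` itself, so uniform convergence in `ℋ`
  -- also gives that of the derivatives.
  have hder : ∀ n t, HasDerivAt (fun τ => A.pivot α hβ (Y n τ)) (-A.extL α hβ (Y n t)) t := by
    intro n t
    obtain ⟨Z, hZ⟩ := hY n
    have h1 := (A.pivotL α hβ).hasFDerivAt.comp_hasDerivAt t (hZ t).1
    rw [map_neg, pivotL_apply, A.pivot_generator α hβ ⟨_, (hZ t).2⟩] at h1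
    exact h1
  refine ⟨U, ⟨hcont.mono hS, fun t => -A.extL α hβ (U t), ?_, fun t ht => ⟨?_, ?_⟩⟩, ?_⟩
  · exact ((A.extL α hβ).continuous.comp_continuousOn (hcont.mono hS)).neg
  · refine (hasDerivAt_of_tendstoUniformlyOn (l := atTop)
      (f := fun n τ => A.pivot α hβ (Y n τ)) (f' := fun n τ => -A.extL α hβ (Y n τ))
      Metric.isOpen_ball (g' := fun τ => -A.extL α hβ (U τ)) ?_
      (Eventually.of_forall fun n t _ => hder n t) (fun τ _ => ?_) (hS ht)).hasDerivWithinAt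
    · exact (-A.extL α hβ).uniformContinuous.comp_tendstoUniformlyOn hunif
    · exact ((A.pivotL α hβ).continuous.tendsto _).comp (hU τ)
  · simp only [neg_neg]
    refine mem_closure_of_tendsto ((hU t).prodMk_nhds
      (((A.extL α hβ).continuous.tendsto _).comp (hU t))) (Eventually.of_forall fun n => ?_)
    obtain ⟨Z, hZ⟩ := hY n
    exact ⟨⟨_, (hZ t).2⟩, Prod.ext rfl (A.pivot_generator α hβ ⟨_, (hZ t).2⟩)⟩
  · exact tendsto_nhds_unique (hU 0) hlim0

end CoerciveOp

/-! ### From the equation in `D(𝒜)'` to the second order system. -/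

/-- A function with continuous weak derivative, tested on a total set, is differentiable. -/
lemma hasDerivWithinAt_of_forall_inner {H : Type*} [NormedAddCommGroup H] [InnerProductSpace ℝ H]
    [CompleteSpace H] {S : Set H} (hS : ∀ h : H, (∀ e ∈ S, ⟪h, e⟫_ℝ = 0) → h = 0) {T : ℝ}
    (hT : 0 < T) {f g : ℝ → H} (hg : ContinuousOn g (Icc 0 T))
    (hf : ∀ e ∈ S, ∀ t ∈ Icc 0 T,
      HasDerivWithinAt (fun τ => ⟪f τ, e⟫_ℝ) ⟪g t, e⟫_ℝ (Icc 0 T) t) {t : ℝ} (ht : t ∈ Icc 0 T) :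
    HasDerivWithinAt f (g t) (Icc 0 T) t := by
  -- `g` is extended by constants beyond `[0,T]`, so its primitive `F` is differentiable everywhere,
  -- and `f = F` is checked against `S`.
  set G : ℝ → H := IccExtend hT.le ((Icc 0 T).domRestrict g)
  have hGc : Continuous G := (continuousOn_iff_continuous_domRestrict.mp hg).Icc_extend'
  have hGg : ∀ s ∈ Icc 0 T, G s = g s := fun s hs => IccExtend_of_mem hT.le _ hs
  set F : ℝ → H := fun s => f 0 + ∫ τ in (0 : ℝ)..s, G τ
  have hF : ∀ s, HasDerivAt F (G s) s := fun s =>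
    (hGc.integral_hasStrictDerivAt 0 s).hasDerivAt.const_add _
  have hfF : ∀ s ∈ Icc 0 T, f s = F s := by
    intro s hs
    refine sub_eq_zero.mp (hS _ fun e he => ?_)
    have hd : ∀ τ ∈ Icc 0 T, HasDerivWithinAt (fun τ => ⟪f τ - F τ, e⟫_ℝ) 0 (Icc 0 T) τ := by
      intro τ hτ
      have h1 := (hf e he τ hτ).sub
        ((hF τ).inner ℝ (hasDerivAt_const τ e)).hasDerivWithinAt
      simp only [inner_sub_left]
      exact h1.congr_deriv (by rw [hGg τ hτ, inner_zero_right, zero_add, sub_self])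
    have hc := constant_of_has_deriv_right_zero
      (fun τ hτ => (hd τ hτ).continuousWithinAt)
      (fun τ hτ => (hd τ (Ico_subset_Icc_self hτ)).mono_of_mem_nhdsWithin
        (Icc_mem_nhdsGE_of_mem hτ)) s hs
    rw [hc]
    simp [F]
  have h := (hF t).hasDerivWithinAt (s := Icc 0 T)
  rw [hGg t ht] at h
  exact h.congr hfF (hfF t ht)

namespace CoerciveOp

variable {H : Type*} [NormedAddCommGroup H] [InnerProductSpace ℝ H] [CompleteSpace H]
  (A : CoerciveOp H)

lemma energy_eq (α β : ℝ) (U Φ : A.State) : A.energy α β U Φ =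
    A.formV α β U.1 U.2.1 Φ.1 + A.formW α β U.1 U.2.1 Φ.2.1 +
      ⟪U.2.2.1, Φ.2.2.1⟫_ℝ + ⟪U.2.2.2, Φ.2.2.2⟫_ℝ := by
  rw [energy_comm, energy, real_inner_comm, real_inner_comm U.2.2.2]

lemma formV_smul (α β c : ℝ) (u : A.V) (v : A.W) (r : A.V) :
    A.formV α β u v (c • r) = c * A.formV α β u v r := by
  rw [formV, formV, map_smul, real_inner_smul_right, coupling_smul_right]
  ring

lemma formW_smul (α β c : ℝ) (u : A.V) (v : A.W) (s : A.W) :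
    A.formW α β u v (c • s) = c * A.formW α β u v s := by
  rw [formW, formW, map_smul, real_inner_smul_right, coupling_smul_left]
  ring

@[simp] lemma formV_zero (α β : ℝ) (u : A.V) (v : A.W) : A.formV α β u v 0 = 0 := by
  simpa using A.formV_smul α β 0 u v 0

@[simp] lemma formW_zero (α β : ℝ) (u : A.V) (v : A.W) : A.formW α β u v 0 = 0 := by
  simpa using A.formW_smul α β 0 u v 0

@[simp] lemma formV_neg (α β : ℝ) (u : A.V) (v : A.W) (r : A.V) :
    A.formV α β u v (-r) = -A.formV α β u v r := by
  simpa using A.formV_smul α β (-1) u v r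

@[simp] lemma formW_neg (α β : ℝ) (u : A.V) (v : A.W) (s : A.W) :
    A.formW α β u v (-s) = -A.formW α β u v s := by
  simpa using A.formW_smul α β (-1) u v s

@[simp] lemma formV_zero_zero (α β : ℝ) (r : A.V) : A.formV α β 0 0 r = 0 := by
  have h : A.coupling β 0 r = 0 := by simpa using A.coupling_smul_left β 0 0 r
  simp [formV, h]

@[simp] lemma formW_zero_zero (α β : ℝ) (s : A.W) : A.formW α β 0 0 s = 0 := by
  have h : A.coupling β s 0 = 0 := by simpa using A.coupling_smul_right β 0 s 0
  simp [formW, h]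

variable {A}

/-- The weak form of `U' + 𝒜 U = 0`. -/
lemma IsSolution.hasDerivWithinAt_energy {α β : ℝ} {hβ : β ≤ 3 / 2} {T : ℝ} {U : ℝ → A.State}
    (hU : A.IsSolution α hβ T U) {Φ Φ' : A.State} (hΦ : (Φ, Φ') ∈ A.generator α hβ) {t : ℝ}
    (ht : t ∈ Icc 0 T) :
    HasDerivWithinAt (fun τ => A.energy α β (U τ) Φ)
      (A.energy α β (U t) Φ' - 2 * ⟪(U t).2.2.1, Φ.2.2.1⟫_ℝ) (Icc 0 T) t := by
  obtain ⟨-, L, -, hL⟩ := hU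
  obtain ⟨h1, h2⟩ := hL t ht
  -- Membership in the closed graph determines the derivative `L t`.
  have h3 := A.eq_extL_of_mem_extGenerator h2
  have h4 := (ContinuousLinearMap.apply ℝ ℝ
    (⟨(Φ, Φ'), hΦ⟩ : A.generator α hβ)).hasFDerivAt.comp_hasDerivWithinAt t h1
  refine h4.congr_deriv ?_
  have h5 := A.energy_adjointGenerator α hβ (U t) ⟨(Φ, Φ'), hΦ⟩
  rw [← extL_apply, ← h3] at h5
  have h6 : (-L t) ⟨(Φ, Φ'), hΦ⟩ = -(L t ⟨(Φ, Φ'), hΦ⟩) := rfl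
  rw [h6] at h5
  change L t ⟨(Φ, Φ'), hΦ⟩ = _
  simp only at h5
  linarith

/-- The test element is `Φ = (0, 0, r, 0)` with `𝒜Φ = (-r, 0, r, 0)`. The adjoint correction `-2⟨w,
r⟩` turns the `+⟨w, r⟩` from `𝒜Φ` into the damping term. -/
lemma IsSolution.hasDerivWithinAt_inner_w {α β : ℝ} {hβ : β ≤ 3 / 2} {T : ℝ} {U : ℝ → A.State}
    (hU : A.IsSolution α hβ T U) (r : A.V) {t : ℝ} (ht : t ∈ Icc 0 T) :
    HasDerivWithinAt (fun τ => ⟪(U τ).2.2.1, A.inclV r⟫_ℝ)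
      (-(⟪(U t).2.2.1, A.inclV r⟫_ℝ + A.formV α β (U t).1 (U t).2.1 r)) (Icc 0 T) t := by
  have hΦ : (((0, 0, A.inclV r, 0), (-r, 0, A.inclV r, 0)) : A.State × A.State) ∈
      A.generator α hβ := by
    refine ⟨?_, ?_, fun r' => ?_, fun s => ?_⟩ <;> simp
  have h := hU.hasDerivWithinAt_energy hΦ ht
  simp only [energy_eq, formV_zero, formW_zero, formV_neg, inner_zero_right, add_zero,
    zero_add] at h
  exact h.congr_deriv (by ring)

lemma IsSolution.hasDerivWithinAt_inner_z {α β : ℝ} {hβ : β ≤ 3 / 2} {T : ℝ} {U : ℝ → A.State}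
    (hU : A.IsSolution α hβ T U) (s : A.W) {t : ℝ} (ht : t ∈ Icc 0 T) :
    HasDerivWithinAt (fun τ => ⟪(U τ).2.2.2, A.inclW s⟫_ℝ)
      (-A.formW α β (U t).1 (U t).2.1 s) (Icc 0 T) t := by
  have hΦ : (((0, 0, 0, A.inclW s), (0, -s, 0, 0)) : A.State × A.State) ∈
      A.generator α hβ := by
    refine ⟨?_, ?_, fun r' => ?_, fun s => ?_⟩ <;> simp
  have h := hU.hasDerivWithinAt_energy hΦ ht
  simp only [energy_eq, formV_zero, formW_zero, formW_neg, inner_zero_right, add_zero,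
    zero_add] at h
  exact h.congr_deriv (by ring)

/-- The test element is `(f e, g e, 0, 0)`: it pairs with `u, v`, while its image under `𝒜` pairs
with `w, z` through the same coefficients. -/
lemma IsSolution.hasDerivWithinAt_inner_eigen {α β : ℝ} {hβ : β ≤ 3 / 2} {T : ℝ}
    {U : ℝ → A.State} (hU : A.IsSolution α hβ T U) {μ : ℝ} (e : A.eigenspace μ) (f g : ℝ) {t : ℝ}
    (ht : t ∈ Icc 0 T) :
    HasDerivWithinAt (fun τ => (f * μ + g * (α * μ ^ β)) * ⟪A.inclV (U τ).1, (e : H)⟫_ℝ +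
        (g * μ ^ 2 + f * (α * μ ^ β)) * ⟪A.inclW (U τ).2.1, (e : H)⟫_ℝ)
      ((f * μ + g * (α * μ ^ β)) * ⟪(U t).2.2.1, (e : H)⟫_ℝ +
        (g * μ ^ 2 + f * (α * μ ^ β)) * ⟪(U t).2.2.2, (e : H)⟫_ℝ) (Icc 0 T) t := by
  have hΦ := A.modeState_mem_generator α hβ ((f • e, g • e, 0, 0) : A.Mode μ)
  have h := hU.hasDerivWithinAt_energy hΦ ht
  simp only [modeState_apply, modeGenerator_apply, energy_eq, map_smul, formV_smul, formW_smul,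
    formV_eigenV, formW_eigenW, neg_zero, map_zero, formV_zero, formW_zero, Submodule.coe_zero,
    Submodule.coe_add, Submodule.coe_smul, inner_zero_right, inner_add_right,
    real_inner_smul_right, add_zero, zero_add, mul_zero, sub_zero] at h
  refine (h.congr_deriv ?_).congr_of_mem (fun τ _ => ?_) ht <;> ring

lemma IsSolution.hasDerivWithinAt_inner_incl {α β : ℝ} {hβ : β ≤ 3 / 2}
    (hα : |α| < A.lambda1 ^ ((3 - 2 * β) / 2)) {T : ℝ} {U : ℝ → A.State}
    (hU : A.IsSolution α hβ T U) {μ : ℝ} (e : A.eigenspace μ) {t : ℝ} (ht : t ∈ Icc 0 T) :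
    HasDerivWithinAt (fun τ => ⟪A.inclV (U τ).1, (e : H)⟫_ℝ) ⟪(U t).2.2.1, (e : H)⟫_ℝ
      (Icc 0 T) t ∧
    HasDerivWithinAt (fun τ => ⟪A.inclW (U τ).2.1, (e : H)⟫_ℝ) ⟪(U t).2.2.2, (e : H)⟫_ℝ
      (Icc 0 T) t := by
  by_cases h0 : (e : H) = 0
  · simp only [h0, inner_zero_right]
    exact ⟨hasDerivWithinAt_const _ _ _, hasDerivWithinAt_const _ _ _⟩
  have hμ := (A.eq_zero_or_pos e.2).resolve_left h0
  obtain ⟨κ, hκ0, hκ1, hκ⟩ := A.exists_abs_mul_rpow_le hβ hα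
  have hk := hκ μ e e.2 h0
  set b := α * μ ^ β with hb
  have hb' : |α| * μ ^ β = |b| := by rw [hb, abs_mul, abs_of_pos (Real.rpow_pos_of_pos hμ β)]
  set m := μ * μ ^ (1 / 2 : ℝ) with hm
  have hm0 : 0 < m := mul_pos hμ (Real.rpow_pos_of_pos hμ _)
  have hm2 : m ^ 2 = μ ^ 3 := by
    rw [hm, mul_pow, ← Real.rpow_natCast (μ ^ (1 / 2 : ℝ)), ← Real.rpow_mul hμ.le]
    norm_num
    ring
  have hlt : |b| < m := by
    rw [← hb']
    exact hk.trans_lt (by nlinarith)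
  -- This is the determinant of `[[μ, b], [b, μ²]]`; the choices of `f, g` below are the columns of
  -- its inverse.
  have hΔ : μ ^ 3 - b ^ 2 ≠ 0 := by
    rw [← hm2, ← sq_abs b]
    have := abs_nonneg b
    nlinarith
  have key := fun f g => hU.hasDerivWithinAt_inner_eigen e f g ht
  simp only [← hb] at key
  constructor
  · have h := key (μ ^ 2 / (μ ^ 3 - b ^ 2)) (-b / (μ ^ 3 - b ^ 2))
    have e1 : μ ^ 2 / (μ ^ 3 - b ^ 2) * μ + -b / (μ ^ 3 - b ^ 2) * b = 1 := by
      field_simp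
      ring
    have e2 : -b / (μ ^ 3 - b ^ 2) * μ ^ 2 + μ ^ 2 / (μ ^ 3 - b ^ 2) * b = 0 := by
      field_simp
      ring
    simpa only [e1, e2, one_mul, zero_mul, add_zero] using h
  · have h := key (-b / (μ ^ 3 - b ^ 2)) (μ / (μ ^ 3 - b ^ 2))
    have e1 : -b / (μ ^ 3 - b ^ 2) * μ + μ / (μ ^ 3 - b ^ 2) * b = 0 := by
      field_simp
      ring
    have e2 : μ / (μ ^ 3 - b ^ 2) * μ ^ 2 + -b / (μ ^ 3 - b ^ 2) * b = 1 := by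
      field_simp
      ring
    simpa only [e1, e2, one_mul, zero_mul, zero_add] using h

lemma IsSolution.solvesSystem {α β : ℝ} {hβ : β ≤ 3 / 2}
    (hα : |α| < A.lambda1 ^ ((3 - 2 * β) / 2)) {T : ℝ} (hT : 0 < T) {U : ℝ → A.State}
    (hU : A.IsSolution α hβ T U) : A.SolvesSystem α β T U := by
  have hS : ∀ h : H, (∀ e ∈ ⋃ μ, (A.eigenspace μ : Set H), ⟪h, e⟫_ℝ = 0) → h = 0 := fun h hh =>
    A.eq_zero_of_forall_inner_eigenspace fun μ e he => hh e (mem_iUnion.mpr ⟨μ, he⟩)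
  intro t ht
  refine ⟨?_, ?_, fun r => hU.hasDerivWithinAt_inner_w r ht,
    fun s => hU.hasDerivWithinAt_inner_z s ht⟩
  · refine hasDerivWithinAt_of_forall_inner hS hT (g := fun τ => (U τ).2.2.1)
      hU.1.snd.snd.fst (fun e he τ hτ => ?_) ht
    obtain ⟨μ, he⟩ := mem_iUnion.mp he
    exact (hU.hasDerivWithinAt_inner_incl hα ⟨e, he⟩ hτ).1
  · refine hasDerivWithinAt_of_forall_inner hS hT (g := fun τ => (U τ).2.2.2)
      hU.1.snd.snd.snd (fun e he τ hτ => ?_) ht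
    obtain ⟨μ, he⟩ := mem_iUnion.mp he
    exact (hU.hasDerivWithinAt_inner_incl hα ⟨e, he⟩ hτ).2

/-! ### Uniqueness by coordinates. -/

/-- The matrix of `-𝒜` on the coordinates of an eigenvector of `μ`, with `b = α μ ^ β`. -/
noncomputable def coordMatrix (μ b : ℝ) : ℝ × ℝ × ℝ × ℝ →L[ℝ] ℝ × ℝ × ℝ × ℝ :=
  LinearMap.toContinuousLinearMap
    { toFun := fun x => (x.2.2.1, x.2.2.2, -(x.2.2.1 + (μ * x.1 + b * x.2.1)),
        -(μ ^ 2 * x.2.1 + b * x.1))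
      map_add' := fun x y => by
        ext <;> simp only [Prod.fst_add, Prod.snd_add] <;> ring
      map_smul' := fun c x => by
        ext <;> simp only [Prod.smul_fst, Prod.smul_snd, smul_eq_mul, RingHom.id_apply] <;> ring }

/-- The coordinates of a state along `e`. -/
noncomputable def coord (e : H) (U : A.State) : ℝ × ℝ × ℝ × ℝ :=
  (⟪A.inclV U.1, e⟫_ℝ, ⟪A.inclW U.2.1, e⟫_ℝ, ⟪U.2.2.1, e⟫_ℝ, ⟪U.2.2.2, e⟫_ℝ)

lemma SolvesSystem.hasDerivWithinAt_coord {α β T : ℝ} {U : ℝ → A.State}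
    (hU : A.SolvesSystem α β T U) {μ : ℝ} (e : A.eigenspace μ) {t : ℝ} (ht : t ∈ Icc 0 T) :
    HasDerivWithinAt (fun τ => coord (e : H) (U τ))
      (coordMatrix μ (α * μ ^ β) (coord (e : H) (U t))) (Icc 0 T) t := by
  obtain ⟨h1, h2, h3, h4⟩ := hU t ht
  have k1 := h1.inner ℝ (hasDerivWithinAt_const t (Icc 0 T) (e : H))
  have k2 := h2.inner ℝ (hasDerivWithinAt_const t (Icc 0 T) (e : H))
  have k3 := h3 (A.eigenV μ e)
  have k4 := h4 (A.eigenW μ e)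
  rw [inner_zero_right, zero_add] at k1 k2
  rw [formV_eigenV] at k3
  rw [formW_eigenW] at k4
  exact k1.prodMk (k2.prodMk (k3.prodMk k4))

/-- Along each eigenvector the coordinates solve the same linear, hence Lipschitz, ODE with the same
initial value. Totality of eigenvectors and injectivity of `V, W ⊂ H` recover the state. -/
lemma SolvesSystem.eqOn {α β T : ℝ} {U U' : ℝ → A.State} (hU : A.SolvesSystem α β T U)
    (hU' : A.SolvesSystem α β T U') (h0 : U 0 = U' 0) : EqOn U U' (Icc 0 T) := by
  have key : ∀ μ, ∀ e : A.eigenspace μ, ∀ t ∈ Icc 0 T,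
      coord (e : H) (U t) = coord (e : H) (U' t) := by
    intro μ e
    have hr : ∀ {U : ℝ → A.State}, A.SolvesSystem α β T U → ∀ t ∈ Ico 0 T,
        HasDerivWithinAt (fun τ => coord (e : H) (U τ))
          (coordMatrix μ (α * μ ^ β) (coord (e : H) (U t))) (Ici t) t := fun h t ht =>
      (h.hasDerivWithinAt_coord e (Ico_subset_Icc_self ht)).mono_of_mem_nhdsWithin
        (Icc_mem_nhdsGE_of_mem ht)
    exact ODE_solution_unique (v := fun _ => coordMatrix μ (α * μ ^ β))
      (fun _ => (coordMatrix μ (α * μ ^ β)).lipschitz)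
      (fun t ht => (hU.hasDerivWithinAt_coord e ht).continuousWithinAt) (hr hU)
      (fun t ht => (hU'.hasDerivWithinAt_coord e ht).continuousWithinAt) (hr hU')
      (by rw [h0])
  intro t ht
  have hext : ∀ x y : H, (∀ μ, ∀ e : A.eigenspace μ, ⟪x, (e : H)⟫_ℝ = ⟪y, (e : H)⟫_ℝ) → x = y :=
    fun x y h => sub_eq_zero.mp <| A.eq_zero_of_forall_inner_eigenspace fun μ e he => by
      rw [inner_sub_left, h μ ⟨e, he⟩, sub_self]
  refine Prod.ext (A.inclV_injective ?_) (Prod.ext (A.inclW_injective ?_) (Prod.ext ?_ ?_))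
  · exact hext _ _ fun μ e => congrArg (fun x => x.1) (key μ e t ht)
  · exact hext _ _ fun μ e => congrArg (fun x => x.2.1) (key μ e t ht)
  · exact hext _ _ fun μ e => congrArg (fun x => x.2.2.1) (key μ e t ht)
  · exact hext _ _ fun μ e => congrArg (fun x => x.2.2.2) (key μ e t ht)

end CoerciveOp

theorem theorem1 {H : Type*} [NormedAddCommGroup H] [InnerProductSpace ℝ H] [CompleteSpace H]
    (A : CoerciveOp H) (α β : ℝ) (hβ0 : 0 ≤ β) (hβ : β ≤ 3 / 2)
    (hα : |α| < A.lambda1 ^ ((3 - 2 * β) / 2)) (T : ℝ) (hT : 0 < T) (U₀ : A.State) :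
    ∃ U : ℝ → A.State,
      (A.IsSolution α hβ T U ∧ U 0 = U₀) ∧
      A.SolvesSystem α β T U ∧
      ∀ U₁ : ℝ → A.State, A.IsSolution α hβ T U₁ → U₁ 0 = U₀ → EqOn U₁ U (Icc 0 T) := by
  obtain ⟨U, hU, hU0⟩ := A.exists_isSolution hβ hα T U₀
  have hs := hU.solvesSystem hα hT
  exact ⟨U, ⟨hU, hU0⟩, hs, fun U₁ h₁ h₁0 => (h₁.solvesSystem hα hT).eqOn hs (h₁0.trans hU0.symm)⟩
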